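/- **Setting.** Let $p(\theta)>0$ be a differentiable prior density on $\mathbb R^d$, and let the data be partitioned into $S$ nonempty shards $\mathbf x_s=\{x_{s,1},\dots,x_{s,N_s}\}$ with differentiable likelihoods $\theta\mapsto p(x_{s,i}\mid\theta)>0$. Let $\pi(\theta)\propto p(\theta)\prod_{s,i}p(x_{s,i}\mid\theta)$ be the posterior density (assumed proper), let $f_1,\dots,f_S>0$ with $\sum_s f_s=1$ be the shard selection probabilities, let $q_1,\dots,q_S>0$ be everywhere differentiable surrogates with $\log q_s$ Lipschitz continuous, let $q=\prod_s q_s$, and let $m\ge 1$. Assume that the log-likelihood gradients are bounded within each shard: $\|\nabla\log p(x_{s,i}\mid\theta)\|\le\gamma_s$ for all $s,i,\theta$. For a step size $h>0$, the CG-DSGLD chain $(\theta_t)_{t\ge0}$ is $$\theta_{t+1}=\theta_t+\frac h2\Big(\nabla\log p(\theta_t)+\frac{N_{s_t}}{f_{s_t}m}\sum_{j=1}^m\nabla\log p(x_{s_t,i_{t,j}}\mid\theta_t)+\nabla\log q(\theta_t)-\frac1{f_{s_t}}\nabla\log q_{s_t}(\theta_t)\Big)+\eta_t,$$ where at each step $s_t$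 is drawn with probabilities $f_1,\dots,f_S$, the indices $i_{t,1},\dots,i_{t,m}$ are drawn uniformly with replacement from $\{1,\dots,N_{s_t}\}$, $\eta_t\sim\mathcal N(0,hI)$, all draws at different steps are independent, $\eta_t$ is independent of the mini-batch, and everything is independent of the (possibly random) initial state $\theta_0$. **Regularity conditions.** Let $H\subseteq(0,\infty)$ be a set of step sizes and let $\phi\in C^2(\mathbb R^d)$ be a $\pi$-integrable test function, with $\bar\phi=\int\phi\,\pi\,d\theta$. Let $\psi\in C^3(\mathbb R^d)$ solve the Poisson equation $\mathcal L\psi=\phi-\bar\phi$, where $\mathcal L=\frac12\nabla\log\pi\cdot\nabla+\frac12\Delta$. Suppose there are a measurable $\Gamma:\mathbb R^d\to[0,\infty)$, exponents $p_0,\dots,p_3>0$ and $r\ge0$, and finite constants such that, with $p_*=\max_k p_k$ and for all $\theta,\theta'$: 1. $\|D^k\psi(\theta)\|\le C_k\,\Gamma(\theta)^{p_k}$ for $k=0,1,2,3$, and $\|D^2\phi(\theta)\|\le c\,(1+\Gamma(\theta)^{p_*})$; 2. $\log\pi\in C^3$ and $\|D^j\log\pi(\theta)\|\le c\,(1+\Gamma(\theta)^r)$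 for $j=1,2,3$; 3. for every $0<a\le 2p_*+6r$: $\sup_{h\in H}\sup_{t\ge0}\mathbb E\,\Gamma(\theta_t)^a<\infty$; 4. for every $0<a\le 2p_*+6r$: $\sup_{u\in(0,1)}\Gamma(u\theta+(1-u)\theta')^a\le c_a\,(\Gamma(\theta)^a+\Gamma(\theta')^a)$. **Conclusion.** There is a constant $C$, independent of $T$, $h$ and $\epsilon_1,\dots,\epsilon_S$, such that whenever $\epsilon_1,\dots,\epsilon_S$ satisfy $$\frac1{N_s}\sum_{i=1}^{N_s}\Big\|\nabla\log p(x_{s,i}\mid\theta)-N_s^{-1}\nabla\log q_s(\theta)\Big\|^2\le\epsilon_s^2\qquad\text{for all }s\text{ and }\theta,$$ then, for every $h\in H$ and every integer $T\ge1$, the Monte Carlo estimate $\hat\phi=\frac1T\sum_{t=1}^T\phi(\theta_t)$ of the chain with step size $h$ has a finite mean squared error with $$\mathbb E\big(\hat\phi-\bar\phi\big)^2\le C\left(\frac1{mT}\sum_{s=1}^S\frac{N_s^2}{f_s}\,\epsilon_s^2+\frac1{hT}+h^2\right).$$ -/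

import Mathlib

open MeasureTheory ProbabilityTheory InnerProductSpace
open scoped Gradient

/-- The parameter space `ℝ^d` with its Euclidean norm. -/
abbrev Param (d : ℕ) : Type := EuclideanSpace ℝ (Fin d)

/-- A Bayesian model whose data set is partitioned into `S` nonempty shards, together with the
shard selection probabilities and one surrogate likelihood factor per shard.
`lik y θ` is the likelihood `p(y | θ)`; the prior need not be normalized. -/
structure FederatedModel (X : Type*) (d S : ℕ) where
  /-- shard sizes -/
  N : Fin S → ℕ
  N_pos : ∀ s, 0 < N s
  /-- the data points of each shard -/
  x : (s : Fin S) → Fin (N s) → X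
  /-- shard selection probabilities -/
  f : PMF (Fin S)
  f_ne_zero : ∀ s, f s ≠ 0
  prior : Param d → ℝ
  prior_pos : ∀ θ, 0 < prior θ
  prior_diff : Differentiable ℝ prior
  lik : X → Param d → ℝ
  lik_pos : ∀ s i θ, 0 < lik (x s i) θ
  lik_diff : ∀ s i, Differentiable ℝ (lik (x s i))
  /-- surrogates for the shard likelihoods -/
  q : Fin S → Param d → ℝ
  q_pos : ∀ s θ, 0 < q s θ
  q_diff : ∀ s, Differentiable ℝ (q s)

noncomputable section

namespace FederatedModel

variable {X : Type*} {d S : ℕ} (M : FederatedModel X d S)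

instance (s : Fin S) : NeZero (M.N s) := ⟨(M.N_pos s).ne'⟩

/-- The selection probability of a shard as a real number. -/
def prob (s : Fin S) : ℝ := (M.f s).toReal

/-- The unnormalized posterior density. -/
def post (θ : Param d) : ℝ := M.prior θ * ∏ s, ∏ i, M.lik (M.x s i) θ

/-- The unnormalized log-posterior. -/
def logPost (θ : Param d) : ℝ := Real.log (M.post θ)

/-- The posterior expectation of `φ`. -/
def postMean (φ : Param d → ℝ) : ℝ := (∫ θ, φ θ * M.post θ) / ∫ θ, M.post θ

/-- `∇ log p(x_{s,i} | θ)`. -/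
def gradLik (s : Fin S) (i : Fin (M.N s)) (θ : Param d) : Param d :=
  ∇ (fun η => Real.log (M.lik (M.x s i) η)) θ

/-- `∇ log q_s(θ)`. -/
def gradSurr (s : Fin S) (θ : Param d) : Param d := ∇ (fun η => Real.log (M.q s η)) θ

/-- A shard together with `m` (not necessarily distinct) data points of it. -/
abbrev Batch (m : ℕ) : Type := (s : Fin S) × (Fin m → Fin (M.N s))

/-- The law of a mini-batch: the shard is drawn with the selection probabilities, then `m` points
are drawn from it independently and uniformly, with replacement. -/
def batchPMF (m : ℕ) : PMF (M.Batch m) :=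
  M.f.bind fun s => (PMF.uniformOfFintype (Fin m → Fin (M.N s))).map (Sigma.mk s)

/-- The DSGLD gradient estimator. -/
def dsgldGrad {m : ℕ} (b : M.Batch m) (θ : Param d) : Param d :=
  ∇ (fun η => Real.log (M.prior η)) θ
    + ((M.N b.1 : ℝ) / (M.prob b.1 * m)) • ∑ j, M.gradLik b.1 (b.2 j) θ

/-- The conducive gradient with respect to shard `s`, with `q = ∏ s, q_s`. -/
def conduciveGrad (s : Fin S) (θ : Param d) : Param d :=
  ∇ (fun η => Real.log (∏ s', M.q s' η)) θ - (M.prob s)⁻¹ • M.gradSurr s θ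

/-- The CG-DSGLD chain with constant step size `h`, driven by the initial state `θ₀`, the
mini-batches `B 0, B 1, …` and the standard Gaussian vectors `ξ 0, ξ 1, …`;
the injected noise at each step is `√h • ξ t`, of law `𝒩(0, h I)`. -/
def chain {m : ℕ} {Ω : Type*} (θ₀ : Ω → Param d) (B : ℕ → Ω → M.Batch m)
    (ξ : ℕ → Ω → Param d) (h : ℝ) : ℕ → Ω → Param d
  | 0, ω => θ₀ ω
  | t + 1, ω =>
      chain θ₀ B ξ h t ω
        + (h / 2) • (M.dsgldGrad (B t ω) (chain θ₀ B ξ h t ω)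
            + M.conduciveGrad (B t ω).1 (chain θ₀ B ξ h t ω))
        + Real.sqrt h • ξ t ω

/-- The joint law of the randomness that drives the chain: the pairs `(B t, ξ t)` are i.i.d., with
`B t` a random mini-batch and `ξ t` an independent standard Gaussian vector, and they are
independent of the initial state. -/
structure IsDriving {m : ℕ} {Ω : Type*} [MeasurableSpace Ω] (P : Measure Ω)
    (θ₀ : Ω → Param d) (B : ℕ → Ω → M.Batch m) (ξ : ℕ → Ω → Param d) : Prop where
  measurable_init : Measurable θ₀
  measurable_batch : ∀ t, Measurable (B t)
  measurable_noise : ∀ t, Measurable (ξ t)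
  law : ∀ t, P.map (fun ω => (B t ω, ξ t ω))
    = (M.batchPMF m).toMeasure.prod (stdGaussian (Param d))
  iIndep : iIndepFun (fun t ω => (B t ω, ξ t ω)) P
  indep_init : IndepFun θ₀ (fun ω t => (B t ω, ξ t ω)) P

/-- The generator `L ψ = ½ ⟨∇ log π, ∇ ψ⟩ + ½ Δ ψ` of the Langevin diffusion
`dθ = ½ ∇ log π(θ) dt + dW` that leaves the posterior `π` invariant. -/
def generator (ψ : Param d → ℝ) (θ : Param d) : ℝ :=
  (1 / 2) * inner ℝ (∇ M.logPost θ) (∇ ψ θ) + (1 / 2) * Laplacian.laplacian ψ θ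

end FederatedModel

/-- The Monte Carlo average `T⁻¹ ∑_{t=1}^T φ(θ_t)`. -/
def mcAverage {Ω E : Type*} (φ : E → ℝ) (θ : ℕ → Ω → E) (T : ℕ) (ω : Ω) : ℝ :=
  (T : ℝ)⁻¹ * ∑ t ∈ Finset.Icc 1 T, φ (θ t ω)

end

/-! Write `L = φ - φ̄`, which by the Poisson equation is the Langevin generator applied to `ψ`. One
step of the chain changes `ψ` by `h L(θ_t)`, plus a martingale increment, plus a conditional bias.
Summing over `t = 1, …, T` telescopes `ψ`, so `h ∑ L(θ_t)` equals a boundary term minus a martingale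
minus the accumulated bias. In mean square these are of order `1`, `h T` and `T² h⁴`; dividing by
`(h T)²` gives `(h T)⁻² + (h T)⁻¹ + h²`. When `(h T)⁻¹ + h² ≥ 1`, the moment bound on `L` alone
suffices, so otherwise `h ≤ 1` and `(h T)⁻¹ ≤ 1` may be assumed
(`IsNoiseDriven.integral_average_sq_le`).

The bias must be `O(h²)` although `ψ` is only `C³`, one derivative short of the usual Taylor
argument. The missing regularity comes from the Poisson equation: `Δψ = 2(φ - φ̄) - ⟨∇ log π, ∇ψ⟩`
is `C²` with controlled growth. The Gaussian part of a step is then expanded by the heat equation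
`d/du 𝔼 g(y + uξ) = u 𝔼 Δg(y + uξ)`, applied first to `ψ` and then to `Δψ`; the drift part is
expanded by Taylor's formula (`IsWeight.abs_integral_step_sub_le`). The martingale increments are
`O(h)` in mean square by a Gaussian Poincaré inequality (`IsWeight.integral_step_sub_sq_le`).

All growth is measured by one weight `w = (1 + Γ)^κ` with `κ = p_* + 2r`. Convexity along segments
bounds `w` at intermediate points by its values at the two ends of a step, and the moments of order
`2κ` are uniformly bounded along the chain.

The stochastic gradient enters in two ways. It is unbiased (`FederatedModel.integral_drift`), so the
first-order term of the averaged step is exactly the generator. It also differs from `∇ log π` by a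
bounded vector (`FederatedModel.norm_drift_le`), so its second-order effect falls within the `h²`
bias and its fluctuation within the `O(h)` increments. The estimate therefore already holds with
right-hand side `C((h T)⁻¹ + h²)`, and the nonnegative mini-batch term is added at the end. -/

section Laplacian

/-! ### Second derivatives and the Laplacian. -/

variable {E : Type*} [NormedAddCommGroup E] [InnerProductSpace ℝ E]

theorem fderiv_fderiv_comp_add_smul {g : E → ℝ} (hg : ContDiff ℝ 2 g) (y : E) (u : ℝ) (v w x : E) :
    HasFDerivAt (fun x => fderiv ℝ g (y + u • x) v)
      ((ContinuousLinearMap.apply ℝ ℝ v).comp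
        ((fderiv ℝ (fderiv ℝ g) (y + u • x)).comp (u • ContinuousLinearMap.id ℝ E))) x ∧
    ((ContinuousLinearMap.apply ℝ ℝ v).comp
        ((fderiv ℝ (fderiv ℝ g) (y + u • x)).comp (u • ContinuousLinearMap.id ℝ E))) w
      = u * iteratedFDeriv ℝ 2 g (y + u • x) ![w, v] := by
  constructor
  · have h1 : HasFDerivAt (fun x : E => y + u • x) (u • ContinuousLinearMap.id ℝ E) x :=
      ((hasFDerivAt_id x).const_smul u).const_add y
    have h2 : Differentiable ℝ (fderiv ℝ g) :=
      (hg.fderiv_right (m := 1) (by norm_num)).differentiable (by norm_num)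
    exact (ContinuousLinearMap.apply ℝ ℝ v).hasFDerivAt.comp x ((h2 _).hasFDerivAt.comp x h1)
  · simp [iteratedFDeriv_two_apply]

theorem norm_iteratedFDeriv_two_apply_le {g : E → ℝ} (z v w : E) :
    ‖iteratedFDeriv ℝ 2 g z ![v, w]‖ ≤ ‖iteratedFDeriv ℝ 2 g z‖ * ‖v‖ * ‖w‖ := by
  have := (iteratedFDeriv ℝ 2 g z).le_opNorm ![v, w]
  simpa [Fin.prod_univ_two, mul_assoc] using this

variable [FiniteDimensional ℝ E]

theorem abs_laplacian_le {g : E → ℝ} (z : E) :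
    |Laplacian.laplacian g z| ≤ Module.finrank ℝ E * ‖iteratedFDeriv ℝ 2 g z‖ := by
  rw [laplacian_eq_iteratedFDeriv_stdOrthonormalBasis]
  refine (Finset.abs_sum_le_sum_abs _ _).trans ?_
  refine (Finset.sum_le_card_nsmul _ _ ‖iteratedFDeriv ℝ 2 g z‖ fun i _ => ?_).trans (by simp)
  simpa using norm_iteratedFDeriv_two_apply_le (g := g) z (stdOrthonormalBasis ℝ E i)
    (stdOrthonormalBasis ℝ E i)

end Laplacian

/-! ### Gaussian calculus: density, Stein's lemma, heat equation, Poincaré inequality. -/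

section Gaussian

variable {E : Type*} [NormedAddCommGroup E] [InnerProductSpace ℝ E] [FiniteDimensional ℝ E]
  [MeasurableSpace E] [BorelSpace E]

theorem integrable_exp_neg_half_sq_norm :
    Integrable (fun x : E => Real.exp (-(1 / 2) * ‖x‖ ^ 2)) := by
  have h := (GaussianFourier.integrable_cexp_neg_mul_sq_norm_add (V := E)
    (b := ((1 / 2 : ℝ) : ℂ)) (by norm_num) 0 0).norm
  refine h.congr (Filter.Eventually.of_forall fun x => ?_)
  simp only [Complex.norm_exp]
  congr 1
  simp [← Complex.ofReal_pow]

variable (E) in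
/-- The normalizing constant of the standard Gaussian density. -/
noncomputable def gaussianNormalizer : ℝ := ((2 * Real.pi) ^ (Module.finrank ℝ E / 2 : ℝ))⁻¹

theorem gaussianNormalizer_pos {E : Type*} [NormedAddCommGroup E] [InnerProductSpace ℝ E] :
    0 < gaussianNormalizer E := by
  unfold gaussianNormalizer; positivity

/-- The standard Gaussian measure has density `(2π)^(-n/2) exp(-‖x‖²/2)`. -/
theorem stdGaussian_eq_withDensity :
    stdGaussian E = (volume : Measure E).withDensity
      (fun x => ENNReal.ofReal (gaussianNormalizer E * Real.exp (-(1 / 2) * ‖x‖ ^ 2))) := by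
  have hfin : IsFiniteMeasure ((volume : Measure E).withDensity
      (fun x => ENNReal.ofReal (gaussianNormalizer E * Real.exp (-(1 / 2) * ‖x‖ ^ 2)))) :=
    isFiniteMeasure_withDensity_ofReal
      (integrable_exp_neg_half_sq_norm.const_mul (gaussianNormalizer E)).2
  -- Both sides are finite measures, so comparing characteristic functions suffices; the one of the
  -- density is an explicit Gaussian Fourier integral.
  apply Measure.ext_of_charFun
  ext t
  rw [charFun_stdGaussian, charFun_apply, integral_withDensity_eq_integral_toReal_smul
    (by fun_prop) (by simp)]
  have h := GaussianFourier.integral_cexp_neg_mul_sq_norm_add (V := E)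
    (b := ((1 / 2 : ℝ) : ℂ)) (by norm_num) Complex.I t
  have h2 : ∀ x : E, (ENNReal.ofReal (gaussianNormalizer E * Real.exp (-(1 / 2) * ‖x‖ ^ 2))).toReal
      • Complex.exp (inner ℝ x t * Complex.I)
      = (gaussianNormalizer E : ℂ) *
        Complex.exp (-((1 / 2 : ℝ) : ℂ) * ‖x‖ ^ 2 + Complex.I * inner ℝ t x) := by
    intro x
    rw [ENNReal.toReal_ofReal (mul_nonneg gaussianNormalizer_pos.le (Real.exp_pos _).le),
      Complex.exp_add, Complex.real_smul]
    push_cast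
    rw [real_inner_comm, mul_comm (Complex.I)]
    ring
  simp_rw [h2]
  rw [integral_const_mul, h]
  have h3 : ((Real.pi : ℂ) / ((1 / 2 : ℝ) : ℂ)) ^ (Module.finrank ℝ E / 2 : ℂ)
      = (((2 * Real.pi) ^ (Module.finrank ℝ E / 2 : ℝ) : ℝ) : ℂ) := by
    rw [Complex.ofReal_cpow (by positivity)]
    push_cast
    congr 1
    ring
  rw [h3, ← mul_assoc, ← Complex.ofReal_mul, gaussianNormalizer,
    inv_mul_cancel₀ (by positivity)]
  simp only [Complex.I_sq, Complex.ofReal_one, one_mul]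
  congr 1
  push_cast
  ring

theorem integrable_stdGaussian_iff {f : E → ℝ} :
    Integrable f (stdGaussian E) ↔
      Integrable (fun x => f x * Real.exp (-(1 / 2) * ‖x‖ ^ 2)) := by
  rw [stdGaussian_eq_withDensity, integrable_withDensity_iff_integrable_smul' (by fun_prop)
    (by simp), ← integrable_const_mul_iff
      (isUnit_iff_ne_zero.2 (gaussianNormalizer_pos (E := E)).ne') (fun x => f x * _)]
  refine integrable_congr (Filter.Eventually.of_forall fun x => ?_)
  simp only
  rw [ENNReal.toReal_ofReal (mul_nonneg gaussianNormalizer_pos.le (Real.exp_pos _).le), smul_eq_mul]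
  ring

theorem integral_stdGaussian (f : E → ℝ) :
    ∫ x, f x ∂(stdGaussian E)
      = gaussianNormalizer E * ∫ x, f x * Real.exp (-(1 / 2) * ‖x‖ ^ 2) := by
  rw [stdGaussian_eq_withDensity, integral_withDensity_eq_integral_toReal_smul (by fun_prop)
    (by simp), ← integral_const_mul]
  congr 1
  ext x
  rw [ENNReal.toReal_ofReal (mul_nonneg gaussianNormalizer_pos.le (Real.exp_pos _).le), smul_eq_mul]
  ring

/-- **Stein's lemma** for the standard Gaussian measure. -/
theorem integral_mul_inner_stdGaussian {f : E → ℝ} (v : E) (hf : Differentiable ℝ f)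
    (hint : Integrable f (stdGaussian E))
    (hmul : Integrable (fun x => f x * inner ℝ x v) (stdGaussian E))
    (hderiv : Integrable (fun x => fderiv ℝ f x v) (stdGaussian E)) :
    ∫ x, f x * inner ℝ x v ∂(stdGaussian E) = ∫ x, fderiv ℝ f x v ∂(stdGaussian E) := by
  have hd : ∀ x : E, HasFDerivAt (fun x : E => Real.exp (-(1 / 2) * ‖x‖ ^ 2))
      (Real.exp (-(1 / 2) * ‖x‖ ^ 2) • (-(1 / 2 : ℝ)) • (2 • (innerSL ℝ x))) x := fun x =>
    (((hasStrictFDerivAt_norm_sq x).hasFDerivAt).const_mul _).exp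
  have hfd : ∀ x : E, fderiv ℝ (fun x : E => Real.exp (-(1 / 2) * ‖x‖ ^ 2)) x v
      = -(inner ℝ x v * Real.exp (-(1 / 2) * ‖x‖ ^ 2)) := fun x => by
    rw [(hd x).fderiv]; simp; ring
  rw [integrable_stdGaussian_iff] at hint hmul hderiv
  rw [integral_stdGaussian, integral_stdGaussian]
  congr 1
  -- Integration by parts against `exp(-‖x‖²/2)`, whose derivative along `v` is `-⟨x, v⟩` times
  -- itself.
  have key := integral_mul_fderiv_eq_neg_fderiv_mul_of_integrable (μ := (volume : Measure E))
    (f := f) (g := fun x : E => Real.exp (-(1 / 2) * ‖x‖ ^ 2)) (v := v) hderiv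
    (by
      refine hmul.neg.congr (Filter.Eventually.of_forall fun x => ?_)
      simp only [hfd, Pi.neg_apply]; ring) hint (fun x _ => hf x)
      (fun x _ => (hd x).differentiableAt)
  rw [← neg_eq_iff_eq_neg, ← integral_neg] at key
  rw [← key]
  congr 1
  ext x
  rw [hfd]
  ring

theorem integrable_mul_norm_stdGaussian {Φ : E → ℝ} (hΦ : MemLp Φ 2 (stdGaussian E)) :
    Integrable (fun x => Φ x * ‖x‖) (stdGaussian E) :=
  hΦ.integrable_mul (IsGaussian.memLp_two_id (μ := stdGaussian E)).norm

/-- The left side is the derivative in `u` of the Gaussian average of `g(y + u x)`. Expanding `x` in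
an orthonormal basis and applying Stein's lemma to each `∂ᵢg(y + u x)` produces `u ∂ᵢᵢg`. The
envelope `Φ` is taken in `L²` so that `Φ ‖x‖` is integrable. -/
theorem integral_fderiv_comp_add_smul_stdGaussian {g : E → ℝ} (hg : ContDiff ℝ 2 g) (y : E)
    (u : ℝ) {Φ : E → ℝ} (hΦ : MemLp Φ 2 (stdGaussian E))
    (hD1 : ∀ x, ‖fderiv ℝ g (y + u • x)‖ ≤ Φ x)
    (hD2 : ∀ x, ‖iteratedFDeriv ℝ 2 g (y + u • x)‖ ≤ Φ x) :
    ∫ x, fderiv ℝ g (y + u • x) x ∂(stdGaussian E)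
      = u * ∫ x, Laplacian.laplacian g (y + u • x) ∂(stdGaussian E) := by
  have hΦi : Integrable Φ (stdGaussian E) := hΦ.integrable (by norm_num)
  have hc1 : Continuous (fun x => fderiv ℝ g (y + u • x)) :=
    (hg.continuous_fderiv (by norm_num)).comp (by fun_prop)
  have hc2 : Continuous (fun x => iteratedFDeriv ℝ 2 g (y + u • x)) :=
    (hg.continuous_iteratedFDeriv (m := 2) (by norm_num)).comp (by fun_prop)
  set b := stdOrthonormalBasis ℝ E with hb
  have hi1 : ∀ i, Integrable (fun x => fderiv ℝ g (y + u • x) (b i)) (stdGaussian E) := fun i => by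
    refine hΦi.mono' (hc1.clm_apply continuous_const).aestronglyMeasurable
      (Filter.Eventually.of_forall fun x => ?_)
    refine (ContinuousLinearMap.le_opNorm _ _).trans ?_
    simpa using hD1 x
  have hi2 : ∀ i, Integrable (fun x => fderiv ℝ g (y + u • x) (b i) * inner ℝ x (b i))
      (stdGaussian E) := fun i => by
    refine (integrable_mul_norm_stdGaussian hΦ).mono' (by fun_prop)
      (Filter.Eventually.of_forall fun x => ?_)
    rw [norm_mul]
    gcongr
    · exact (norm_nonneg _).trans (hD1 x)
    · refine (ContinuousLinearMap.le_opNorm _ _).trans ?_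
      simpa using hD1 x
    · exact (norm_inner_le_norm _ _).trans (by simp)
  have hi3 : ∀ i, Integrable (fun x => iteratedFDeriv ℝ 2 g (y + u • x) ![b i, b i])
      (stdGaussian E) := fun i => by
    refine hΦi.mono' ((ContinuousMultilinearMap.apply ℝ (fun _ : Fin 2 => E) ℝ
      _).continuous.comp hc2).aestronglyMeasurable (Filter.Eventually.of_forall fun x => ?_)
    exact (norm_iteratedFDeriv_two_apply_le _ _ _).trans (by simpa using hD2 x)
  have hstein : ∀ i, ∫ x, fderiv ℝ g (y + u • x) (b i) * inner ℝ x (b i) ∂(stdGaussian E)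
      = u * ∫ x, iteratedFDeriv ℝ 2 g (y + u • x) ![b i, b i] ∂(stdGaussian E) := fun i => by
    have hfd : ∀ x, fderiv ℝ (fun x => fderiv ℝ g (y + u • x) (b i)) x (b i)
        = u * iteratedFDeriv ℝ 2 g (y + u • x) ![b i, b i] := fun x => by
      rw [(fderiv_fderiv_comp_add_smul hg y u (b i) (b i) x).1.fderiv]
      exact (fderiv_fderiv_comp_add_smul hg y u (b i) (b i) x).2
    rw [integral_mul_inner_stdGaussian (b i)
      (fun x => (fderiv_fderiv_comp_add_smul hg y u (b i) (b i) x).1.differentiableAt)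
      (hi1 i) (hi2 i) (by simpa only [hfd] using (hi3 i).const_mul u)]
    simp_rw [hfd]
    rw [integral_const_mul]
  have hexp : ∀ x, fderiv ℝ g (y + u • x) x
      = ∑ i, fderiv ℝ g (y + u • x) (b i) * inner ℝ x (b i) := fun x => by
    have h (A : E →L[ℝ] ℝ) : A x = ∑ i, A (b i) * inner ℝ x (b i) := by
      conv_lhs => rw [← b.sum_repr' x, map_sum]
      exact Finset.sum_congr rfl fun i _ => by
        rw [map_smul, smul_eq_mul, mul_comm, real_inner_comm]
    exact h _
  simp_rw [hexp]
  rw [integral_finsetSum _ fun i _ => hi2 i, laplacian_eq_iteratedFDeriv_stdOrthonormalBasis,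
    integral_finsetSum _ fun i _ => hi3 i, Finset.mul_sum]
  exact Finset.sum_congr rfl fun i _ => hstein i

/-- The heat equation for Gaussian averages of a `C²` function, in integrated form. -/
theorem integral_comp_add_smul_stdGaussian {g : E → ℝ} (hg : ContDiff ℝ 2 g) (y : E) {a : ℝ}
    (ha : 0 ≤ a) {Φ : E → ℝ} (hΦ : MemLp Φ 2 (stdGaussian E))
    (hD1 : ∀ u ∈ Set.Icc 0 a, ∀ x, ‖fderiv ℝ g (y + u • x)‖ ≤ Φ x)
    (hD2 : ∀ u ∈ Set.Icc 0 a, ∀ x, ‖iteratedFDeriv ℝ 2 g (y + u • x)‖ ≤ Φ x) :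
    Integrable (fun x => g (y + a • x)) (stdGaussian E) ∧
    IntervalIntegrable (fun u => u * ∫ x, Laplacian.laplacian g (y + u • x) ∂(stdGaussian E))
      volume 0 a ∧
    ∫ x, g (y + a • x) ∂(stdGaussian E)
      = g y + ∫ u in (0 : ℝ)..a, u * ∫ x, Laplacian.laplacian g (y + u • x) ∂(stdGaussian E) := by
  have hc1 : Continuous (fun q : ℝ × E => fderiv ℝ g (y + q.1 • q.2) q.2) :=
    ((hg.continuous_fderiv (by norm_num)).comp
      (by fun_prop : Continuous fun q : ℝ × E => y + q.1 • q.2)).clm_apply continuous_snd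
  have hftc : ∀ x, ∫ u in (0 : ℝ)..a, fderiv ℝ g (y + u • x) x = g (y + a • x) - g y := fun x => by
    have hder : ∀ u : ℝ, HasDerivAt (fun u : ℝ => g (y + u • x)) (fderiv ℝ g (y + u • x) x) u := by
      intro u
      have h1 : HasDerivAt (fun u : ℝ => y + u • x) x u := by
        simpa using ((hasDerivAt_id u).smul_const x).const_add y
      exact ((hg.differentiable (by norm_num)) _).hasFDerivAt.comp_hasDerivAt u h1
    rw [intervalIntegral.integral_eq_sub_of_hasDerivAt (fun u _ => hder u)]
    · simp
    · exact (hc1.comp (by fun_prop : Continuous fun u : ℝ => (u, x))).intervalIntegrable _ _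
  have hbd := integrable_mul_norm_stdGaussian hΦ
  have hint : Integrable (Function.uncurry fun (u : ℝ) (x : E) => fderiv ℝ g (y + u • x) x)
      ((volume.restrict (Set.Ioc 0 a)).prod (stdGaussian E)) := by
    refine (hbd.comp_snd (volume.restrict (Set.Ioc 0 a))).mono' hc1.aestronglyMeasurable ?_
    have : ∀ᵐ u ∂(volume.restrict (Set.Ioc 0 a)), u ∈ Set.Ioc 0 a :=
      ae_restrict_mem measurableSet_Ioc
    have h2 : ∀ᵐ q ∂((volume.restrict (Set.Ioc 0 a)).prod (stdGaussian E)), q.1 ∈ Set.Ioc 0 a :=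
      Measure.quasiMeasurePreserving_fst.ae this
    filter_upwards [h2] with q hq
    refine (ContinuousLinearMap.le_opNorm _ _).trans ?_
    gcongr
    exact hD1 _ (Set.Ioc_subset_Icc_self hq) _
  have hint2 : Integrable (fun x => g (y + a • x) - g y) (stdGaussian E) := by
    refine (hint.integral_prod_right).congr (Filter.Eventually.of_forall fun x => ?_)
    simp only [Function.uncurry_apply_pair]
    rw [← hftc x, intervalIntegral.integral_of_le ha]
  have hint3 : Integrable (fun x => g (y + a • x)) (stdGaussian E) := by
    refine (hint2.add (integrable_const (g y))).congr (Filter.Eventually.of_forall fun x => ?_)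
    simp
  have hstein : ∀ u ∈ Set.Ioc 0 a, ∫ x, fderiv ℝ g (y + u • x) x ∂(stdGaussian E)
      = u * ∫ x, Laplacian.laplacian g (y + u • x) ∂(stdGaussian E) := fun u hu =>
    integral_fderiv_comp_add_smul_stdGaussian hg y u hΦ
      (hD1 u (Set.Ioc_subset_Icc_self hu)) (hD2 u (Set.Ioc_subset_Icc_self hu))
  have hint4 : IntervalIntegrable
      (fun u => u * ∫ x, Laplacian.laplacian g (y + u • x) ∂(stdGaussian E)) volume 0 a := by
    rw [intervalIntegrable_iff_integrableOn_Ioc_of_le ha]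
    refine hint.integral_prod_left.congr ?_
    filter_upwards [ae_restrict_mem measurableSet_Ioc] with u hu using hstein u hu
  refine ⟨hint3, hint4, ?_⟩
  have h1 : ∫ x, (g (y + a • x) - g y) ∂(stdGaussian E)
      = ∫ u in (0 : ℝ)..a, u * ∫ x, Laplacian.laplacian g (y + u • x) ∂(stdGaussian E) := by
    simp_rw [← hftc, intervalIntegral.integral_of_le ha]
    rw [← integral_integral_swap hint]
    exact setIntegral_congr_fun measurableSet_Ioc hstein
  rw [integral_sub hint3 (integrable_const _), integral_const] at h1
  simp at h1
  linarith

/-- The constant in the Gaussian Poincaré inequality below. -/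
noncomputable def gaussianPoincareConst (E : Type*) [NormedAddCommGroup E] [InnerProductSpace ℝ E]
    [FiniteDimensional ℝ E] [MeasurableSpace E] : ENNReal :=
  ENNReal.ofReal (Real.pi / 2) ^ 2 * ∫⁻ x, ‖x‖ₑ ^ 2 ∂(stdGaussian E)

theorem gaussianPoincareConst_ne_top : gaussianPoincareConst E ≠ ⊤ := by
  refine ENNReal.mul_ne_top (by simp) ?_
  have h := (IsGaussian.memLp_two_id (μ := stdGaussian E)).eLpNorm_lt_top
  rw [eLpNorm_lt_top_iff_lintegral_rpow_enorm_lt_top (by norm_num) (by norm_num)] at h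
  simpa using h.ne

theorem sq_lintegral_le {α : Type*} [MeasurableSpace α] (μ : Measure α) {f : α → ENNReal}
    (hf : AEMeasurable f μ) : (∫⁻ x, f x ∂μ) ^ 2 ≤ μ Set.univ * ∫⁻ x, f x ^ 2 ∂μ := by
  have h := ENNReal.lintegral_mul_le_Lp_mul_Lq μ (p := 2) (q := 2)
    (Real.HolderConjugate.two_two) hf (aemeasurable_const (b := (1 : ENNReal)))
  simp only [Pi.mul_apply, mul_one, ENNReal.one_rpow, lintegral_one] at h
  calc (∫⁻ x, f x ∂μ) ^ 2 ≤ ((∫⁻ x, f x ^ (2 : ℝ) ∂μ) ^ (1 / 2 : ℝ)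
        * μ Set.univ ^ (1 / 2 : ℝ)) ^ 2 := by gcongr
    _ = μ Set.univ * ∫⁻ x, f x ^ 2 ∂μ := by
      rw [mul_pow, ← ENNReal.rpow_mul_natCast, ← ENNReal.rpow_mul_natCast]
      norm_num
      rw [mul_comm]

/-- The Maurey–Pisier rotation argument: join two independent Gaussian points by the quarter circle
`cos t • x + sin t • y`. At each `t`, position and velocity are again independent standard
Gaussians, so the squared speed of `f` has the same mean for every `t`. Extended nonnegative
integrals avoid any integrability assumption on `fderiv ℝ f`. -/
theorem lintegral_sub_sq_stdGaussian_le {f : E → ℝ} (hf : ContDiff ℝ 1 f) :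
    ∫⁻ q, ‖f q.1 - f q.2‖ₑ ^ 2 ∂((stdGaussian E).prod (stdGaussian E))
      ≤ gaussianPoincareConst E * ∫⁻ x, ‖fderiv ℝ f x‖ₑ ^ 2 ∂(stdGaussian E) := by
  set γ := stdGaussian E
  have hcf : Continuous (fderiv ℝ f) := hf.continuous_fderiv (by norm_num)
  set I : Measure ℝ := volume.restrict (Set.Ioc 0 (Real.pi / 2)) with hI
  have hIu : I Set.univ = ENNReal.ofReal (Real.pi / 2) := by simp [hI]
  let F : E × E → ENNReal := fun q => ‖fderiv ℝ f q.1 q.2‖ₑ ^ 2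
  have hFc : Continuous (fun q : E × E => fderiv ℝ f q.1 q.2) :=
    (hcf.comp continuous_fst).clm_apply continuous_snd
  have hFm : Measurable F := hFc.enorm.measurable.pow_const 2
  have hrotc : Continuous (fun r : ℝ × (E × E) => ContinuousLinearMap.rotation r.1 r.2) := by
    simp only [ContinuousLinearMap.rotation_apply]
    fun_prop
  -- The rotation by `t` carries the path in its first coordinate and the velocity in its second;
  -- Cauchy–Schwarz on an interval of length `π / 2` gives the factor.
  have hpath : ∀ q : E × E, ‖f q.1 - f q.2‖ₑ ^ 2
      ≤ ENNReal.ofReal (Real.pi / 2) * ∫⁻ t, F (ContinuousLinearMap.rotation t q) ∂I := by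
    intro q
    have hder : ∀ t : ℝ, HasDerivAt (fun t : ℝ => f (Real.cos t • q.1 + Real.sin t • q.2))
        (fderiv ℝ f (ContinuousLinearMap.rotation t q).1
          (ContinuousLinearMap.rotation t q).2) t := by
      intro t
      have h1 : HasDerivAt (fun t : ℝ => Real.cos t • q.1 + Real.sin t • q.2)
          (-Real.sin t • q.1 + Real.cos t • q.2) t :=
        ((Real.hasDerivAt_cos t).smul_const _).add ((Real.hasDerivAt_sin t).smul_const _)
      simp only [ContinuousLinearMap.rotation_apply]
      exact ((hf.differentiable (by norm_num)) _).hasFDerivAt.comp_hasDerivAt t h1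
    have hcont : Continuous fun t : ℝ =>
        fderiv ℝ f (ContinuousLinearMap.rotation t q).1 (ContinuousLinearMap.rotation t q).2 := by
      have hr : Continuous fun t : ℝ => ContinuousLinearMap.rotation t q := by
        simp only [ContinuousLinearMap.rotation_apply]
        fun_prop
      exact (hcf.comp hr.fst).clm_apply hr.snd
    have hftc := intervalIntegral.integral_eq_sub_of_hasDerivAt (a := 0) (b := Real.pi / 2)
      (fun t _ => hder t) (hcont.intervalIntegrable _ _)
    rw [intervalIntegral.integral_of_le (by positivity)] at hftc
    simp only [Real.cos_pi_div_two, Real.sin_pi_div_two, Real.cos_zero, Real.sin_zero, zero_smul,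
      one_smul, zero_add, add_zero] at hftc
    rw [enorm_sub_rev, ← hftc]
    calc _ ≤ (∫⁻ t, ‖fderiv ℝ f (ContinuousLinearMap.rotation t q).1
            (ContinuousLinearMap.rotation t q).2‖ₑ ∂I) ^ 2 := by
          gcongr; exact enorm_integral_le_lintegral_enorm _
      _ ≤ _ := by
          rw [← hIu]
          exact sq_lintegral_le I hcont.enorm.measurable.aemeasurable
  have hrot : ∀ t : ℝ, ∫⁻ q, F (ContinuousLinearMap.rotation t q) ∂(γ.prod γ)
      = ∫⁻ q, F q ∂(γ.prod γ) := fun t => by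
    conv_rhs => rw [← IsGaussian.map_rotation_eq_self_of_forall_strongDual_eq_zero
      (μ := γ) integral_strongDual_stdGaussian t]
    rw [lintegral_map hFm (ContinuousLinearMap.continuous _).measurable]
  calc _ ≤ ∫⁻ q, ENNReal.ofReal (Real.pi / 2)
          * ∫⁻ t, F (ContinuousLinearMap.rotation t q) ∂I ∂(γ.prod γ) := lintegral_mono hpath
    _ = ENNReal.ofReal (Real.pi / 2) * ∫⁻ t, ∫⁻ q, F (ContinuousLinearMap.rotation t q)
          ∂(γ.prod γ) ∂I := by
        rw [lintegral_const_mul' _ _ (by simp), lintegral_lintegral_swap]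
        exact (hFm.comp (hrotc.measurable.comp measurable_swap)).aemeasurable
    _ = ENNReal.ofReal (Real.pi / 2) ^ 2 * ∫⁻ q, F q ∂(γ.prod γ) := by
        simp_rw [hrot]
        rw [lintegral_const, hIu]
        ring
    _ ≤ ENNReal.ofReal (Real.pi / 2) ^ 2
          * ∫⁻ q, ‖fderiv ℝ f q.1‖ₑ ^ 2 * ‖q.2‖ₑ ^ 2 ∂(γ.prod γ) := by
        gcongr with q
        simp only [F]
        rw [← mul_pow]
        gcongr
        exact ContinuousLinearMap.le_opENorm _ _
    _ = _ := by
        rw [lintegral_prod_mul (hcf.enorm.measurable.pow_const 2).aemeasurable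
          (measurable_enorm.pow_const 2).aemeasurable, gaussianPoincareConst]
        ring

/-- A Gaussian Poincaré inequality, with a non-optimal constant. -/
theorem lintegral_sub_integral_sq_stdGaussian_le {f : E → ℝ} (hf : ContDiff ℝ 1 f)
    (hint : Integrable f (stdGaussian E)) :
    ∫⁻ x, ‖f x - ∫ z, f z ∂(stdGaussian E)‖ₑ ^ 2 ∂(stdGaussian E)
      ≤ gaussianPoincareConst E * ∫⁻ x, ‖fderiv ℝ f x‖ₑ ^ 2 ∂(stdGaussian E) := by
  refine le_trans ?_ (lintegral_sub_sq_stdGaussian_le hf)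
  have hc := hf.continuous
  rw [lintegral_prod _ (by fun_prop)]
  refine lintegral_mono fun x => ?_
  -- The mean is replaced by an independent copy, and Jensen's inequality moves the square inside.
  have h1 : f x - ∫ z, f z ∂(stdGaussian E) = ∫ z, (f x - f z) ∂(stdGaussian E) := by
    rw [integral_sub (integrable_const _) hint]; simp
  rw [h1]
  calc _ ≤ (∫⁻ z, ‖f x - f z‖ₑ ∂(stdGaussian E)) ^ 2 := by
        gcongr; exact enorm_integral_le_lintegral_enorm _
    _ ≤ _ := by
        refine (sq_lintegral_le _ (by fun_prop)).trans ?_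
        simp

end Gaussian

/-! ### Taylor estimates with the increment inside the bound. -/

section Taylor

variable {E : Type*} [NormedAddCommGroup E] [InnerProductSpace ℝ E]

/-- The mean value inequality, stated with the product of derivative and increment because this
product, as in `IsDriftDominated`, is what the weight controls. -/
theorem abs_sub_le_of_fderiv_mul_norm_le {g : E → ℝ} (hg : Differentiable ℝ g) (x v : E) {N : ℝ}
    (hN : ∀ z ∈ segment ℝ x (x + v), ‖fderiv ℝ g z‖ * ‖v‖ ≤ N) : |g (x + v) - g x| ≤ N := by
  rcases eq_or_ne v 0 with rfl | hv
  · simpa using hN x (left_mem_segment ℝ _ _)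
  have hv' : 0 < ‖v‖ := norm_pos_iff.2 hv
  have h := (convex_segment x (x + v)).norm_image_sub_le_of_norm_fderiv_le (𝕜 := ℝ) (f := g)
    (C := N / ‖v‖) (fun z _ => hg z) (fun z hz => (le_div_iff₀ hv').2 (hN z hz))
    (left_mem_segment ℝ _ _) (right_mem_segment ℝ _ _)
  rwa [add_sub_cancel_left, div_mul_cancel₀ _ hv'.ne', Real.norm_eq_abs] at h

/-- Two mean value inequalities: one for `fderiv ℝ g` around `x`, then one for `g` minus its linear
part. The usual factor `1/2` is given up. -/
theorem abs_taylor_two_le_of_iteratedFDeriv_mul_norm_le {g : E → ℝ} (hg : ContDiff ℝ 2 g)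
    (x v : E) {N : ℝ}
    (hN : ∀ z ∈ segment ℝ x (x + v), ‖iteratedFDeriv ℝ 2 g z‖ * ‖v‖ ^ 2 ≤ N) :
    |g (x + v) - g x - fderiv ℝ g x v| ≤ N := by
  rcases eq_or_ne v 0 with rfl | hv
  · simpa using hN x (left_mem_segment ℝ _ _)
  have hv' : 0 < ‖v‖ := norm_pos_iff.2 hv
  have hN0 : 0 ≤ N := le_trans (by positivity) (hN x (left_mem_segment ℝ _ _))
  have hd2 : Differentiable ℝ (fderiv ℝ g) :=
    (hg.fderiv_right (m := 1) (by norm_num)).differentiable (by norm_num)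
  have hseg := convex_segment (𝕜 := ℝ) x (x + v)
  have hfd : ∀ z ∈ segment ℝ x (x + v), ‖fderiv ℝ g z - fderiv ℝ g x‖ ≤ N / ‖v‖ := by
    intro z hz
    have h := hseg.norm_image_sub_le_of_norm_fderiv_le (𝕜 := ℝ) (f := fderiv ℝ g)
      (C := N / ‖v‖ ^ 2) (fun z _ => hd2 z) (fun z hz => by
        rw [le_div_iff₀ (by positivity)]
        have h1 : ‖fderiv ℝ (fderiv ℝ g) z‖ = ‖iteratedFDeriv ℝ 2 g z‖ := by
          have h2 := norm_iteratedFDeriv_fderiv (𝕜 := ℝ) (f := g) (x := z) (n := 1)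
          have h3 := norm_iteratedFDeriv_fderiv (𝕜 := ℝ) (f := fderiv ℝ g) (x := z) (n := 0)
          simp only [norm_iteratedFDeriv_zero] at h3
          rw [h3, zero_add, h2]
        rw [h1]
        exact hN z hz) (left_mem_segment ℝ _ _) hz
    refine h.trans ?_
    have hzx : ‖z - x‖ ≤ ‖v‖ := by
      simpa using norm_sub_le_of_mem_segment hz
    calc N / ‖v‖ ^ 2 * ‖z - x‖ ≤ N / ‖v‖ ^ 2 * ‖v‖ := by gcongr
      _ = N / ‖v‖ := by field_simp
  have h := hseg.norm_image_sub_le_of_norm_fderiv_le' (𝕜 := ℝ) (f := g) (φ := fderiv ℝ g x)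
    (C := N / ‖v‖) (fun z _ => (hg.differentiable (by norm_num)) z) hfd
    (left_mem_segment ℝ _ _) (right_mem_segment ℝ _ _)
  rwa [add_sub_cancel_left, div_mul_cancel₀ _ hv'.ne', Real.norm_eq_abs] at h

end Taylor

/-! ### One step of the discretized dynamics with a fixed drift vector. -/

section OneStep

variable {E : Type*} [NormedAddCommGroup E] [InnerProductSpace ℝ E] [MeasurableSpace E]

/-- A measurable function, bounded below by one, whose values on a segment are controlled by those
at the end points. -/
structure IsWeight (w : E → ℝ) (K : ℝ) : Prop where
  measurable : Measurable w
  one_le : ∀ x, 1 ≤ w x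
  segment : ∀ x y, ∀ u ∈ Set.Icc (0 : ℝ) 1, w (u • x + (1 - u) • y) ≤ K * (w x + w y)

namespace IsWeight

variable {w : E → ℝ} {K : ℝ}

theorem K_nonneg (hw : IsWeight w K) : 0 ≤ K := by
  have h := hw.segment 0 0 1 (by simp)
  have := hw.one_le 0
  simp at h
  nlinarith

/-- The point `y + u • x` lies on the segment from `y` to `y + a • x`. Thus one envelope serves all
noise levels up to `a`, the only level at which integrability is known. -/
theorem smul_le (hw : IsWeight w K) (y x : E) {a u : ℝ} (hu : u ∈ Set.Icc 0 a) :
    w (y + u • x) ≤ K * (w (y + a • x) + w y) := by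
  rcases (hu.1.trans hu.2).eq_or_lt with h0 | hpos
  · obtain rfl : u = a := le_antisymm hu.2 (h0 ▸ hu.1)
    have h := hw.segment (y + u • x) (y + u • x) 1 (by simp)
    subst h0
    simpa using h
  · have h := hw.segment (y + a • x) y (u / a)
      ⟨div_nonneg hu.1 hpos.le, (div_le_one hpos).2 hu.2⟩
    have e : (u / a) • (y + a • x) + (1 - u / a) • y = y + u • x := by
      rw [smul_add, smul_smul, div_mul_cancel₀ _ hpos.ne']; module
    rwa [e] at h

theorem le_of_mem_segment (hw : IsWeight w K) {x y z : E} (hz : z ∈ _root_.segment ℝ x y) :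
    w z ≤ K * (w x + w y) := by
  obtain ⟨a, b, ha, hb, hab, rfl⟩ := hz
  have h := hw.segment x y a ⟨ha, by linarith⟩
  rwa [show 1 - a = b by linarith] at h

end IsWeight

variable [FiniteDimensional ℝ E]

/-- The function `ψ`, its Laplacian, and the first two derivatives of both are dominated
by the weight `w`. -/
structure IsDominated (w : E → ℝ) (c : ℝ) (ψ : E → ℝ) : Prop where
  nonneg : 0 ≤ c
  contDiff : ContDiff ℝ 2 ψ
  contDiff_laplacian : ContDiff ℝ 2 (Laplacian.laplacian ψ)
  abs_le : ∀ x, |ψ x| ≤ c * w x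
  fderiv_le : ∀ x, ‖fderiv ℝ ψ x‖ ≤ c * w x
  iteratedFDeriv_le : ∀ x, ‖iteratedFDeriv ℝ 2 ψ x‖ ≤ c * w x
  fderiv_laplacian_le : ∀ x, ‖fderiv ℝ (Laplacian.laplacian ψ) x‖ ≤ c * w x
  iteratedFDeriv_laplacian_le : ∀ x, ‖iteratedFDeriv ℝ 2 (Laplacian.laplacian ψ) x‖ ≤ c * w x

/-- The products of derivatives of `ψ` with a drift vector `G` at `x` that occur in the expansion
of `ψ` along the drift are dominated by the weight `w`. -/
structure IsDriftDominated (w : E → ℝ) (c : ℝ) (ψ : E → ℝ) (x G : E) : Prop where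
  fderiv_mul_le : ∀ z, ‖fderiv ℝ ψ z‖ * ‖G‖ ≤ c * (w z + w x)
  iteratedFDeriv_mul_le : ∀ z, ‖iteratedFDeriv ℝ 2 ψ z‖ * ‖G‖ ^ 2 ≤ c * (w z + w x)
  fderiv_laplacian_mul_le : ∀ z, ‖fderiv ℝ (Laplacian.laplacian ψ) z‖ * ‖G‖ ≤ c * (w z + w x)

variable [BorelSpace E]

theorem measurePreserving_neg_stdGaussian :
    MeasurePreserving (fun x : E => -x) (stdGaussian E) (stdGaussian E) :=
  ⟨measurable_neg, stdGaussian_map (LinearIsometryEquiv.neg ℝ (E := E))⟩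

namespace IsWeight

variable {w : E → ℝ} {K : ℝ}

/-- The centre `y` is the midpoint of `y + a • x` and `y - a • x`, which have the same law. This
removes `w` at the drifted point `y`, which the chain does not visit, in favour of `w` after the
full step. -/
theorem le_two_mul_integral (hw : IsWeight w K) (y : E) (a : ℝ)
    (hint : Integrable (fun x => w (y + a • x)) (stdGaussian E)) :
    w y ≤ 2 * K * ∫ x, w (y + a • x) ∂(stdGaussian E) := by
  have hneg : Integrable (fun x => w (y + a • -x)) (stdGaussian E) :=
    measurePreserving_neg_stdGaussian.integrable_comp_of_integrable hint
  have hneg_eq : ∫ x, w (y + a • -x) ∂(stdGaussian E) = ∫ x, w (y + a • x) ∂(stdGaussian E) :=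
    measurePreserving_neg_stdGaussian.integral_comp (MeasurableEquiv.neg E).measurableEmbedding
      (fun x => w (y + a • x))
  have hpt : ∀ x, w y ≤ K * (w (y + a • x) + w (y + a • -x)) := fun x => by
    have h := hw.segment (y + a • x) (y + a • -x) (1 / 2) (by norm_num)
    have e : (1 / 2 : ℝ) • (y + a • x) + (1 - 1 / 2 : ℝ) • (y + a • -x) = y := by module
    rwa [e] at h
  have h := integral_mono (integrable_const (w y)) ((hint.add hneg).const_mul K) hpt
  simp only [Pi.add_apply] at h
  rw [integral_const, integral_const_mul, integral_add hint hneg,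
    hneg_eq] at h
  simp at h
  linarith

theorem integral_smul_le (hw : IsWeight w K) (y : E) {a u : ℝ} (hu : u ∈ Set.Icc 0 a)
    (hint : Integrable (fun x => w (y + a • x)) (stdGaussian E)) :
    Integrable (fun x => w (y + u • x)) (stdGaussian E) ∧
    ∫ x, w (y + u • x) ∂(stdGaussian E)
      ≤ K * (1 + 2 * K) * ∫ x, w (y + a • x) ∂(stdGaussian E) := by
  have hd : Integrable (fun x => K * (w (y + a • x) + w y)) (stdGaussian E) :=
    (hint.add (integrable_const _)).const_mul K
  have hi : Integrable (fun x => w (y + u • x)) (stdGaussian E) := by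
    refine hd.mono' (hw.measurable.comp (by fun_prop)).aestronglyMeasurable
      (Filter.Eventually.of_forall fun x => ?_)
    rw [Real.norm_of_nonneg (zero_le_one.trans (hw.one_le _))]
    exact hw.smul_le y x hu
  refine ⟨hi, ?_⟩
  have h := integral_mono hi hd fun x => hw.smul_le y x hu
  rw [integral_const_mul, integral_add hint (integrable_const _)] at h
  simp at h
  have h2 := hw.le_two_mul_integral y a hint
  have := mul_le_mul_of_nonneg_left h2 hw.K_nonneg
  linarith

/-- A Gaussian average of a `C²` function differs from the value at the centre by a multiple of the
variance. -/
theorem abs_integral_sub_le (hw : IsWeight w K) {g : E → ℝ} {c : ℝ} (hc : 0 ≤ c)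
    (hg : ContDiff ℝ 2 g)
    (hD1 : ∀ x, ‖fderiv ℝ g x‖ ≤ c * w x) (hD2 : ∀ x, ‖iteratedFDeriv ℝ 2 g x‖ ≤ c * w x)
    (y : E) {a u : ℝ} (hu : u ∈ Set.Icc 0 a)
    (hint : MemLp (fun x => w (y + a • x)) 2 (stdGaussian E)) :
    Integrable (fun x => g (y + u • x)) (stdGaussian E) ∧
    IntervalIntegrable (fun u => u * ∫ x, Laplacian.laplacian g (y + u • x) ∂(stdGaussian E))
      volume 0 u ∧
    ∫ x, g (y + u • x) ∂(stdGaussian E) = g y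
      + ∫ v in (0 : ℝ)..u, v * ∫ x, Laplacian.laplacian g (y + v • x) ∂(stdGaussian E) ∧
    |∫ x, g (y + u • x) ∂(stdGaussian E) - g y|
      ≤ a ^ 2 * (Module.finrank ℝ E * c * (K * (1 + 2 * K)
        * ∫ x, w (y + a • x) ∂(stdGaussian E))) := by
  have hi := hint.integrable (by norm_num)
  have hΦ : MemLp (fun x => c * (K * (w (y + a • x) + w y))) 2 (stdGaussian E) :=
    ((hint.add (memLp_const (w y))).const_mul K).const_mul c
  have hle : ∀ v ∈ Set.Icc 0 u, ∀ x, c * w (y + v • x) ≤ c * (K * (w (y + a • x) + w y)) :=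
    fun v hv x => mul_le_mul_of_nonneg_left (hw.smul_le y x ⟨hv.1, hv.2.trans hu.2⟩) hc
  obtain ⟨h1, h2, h3⟩ := integral_comp_add_smul_stdGaussian hg y hu.1 hΦ
    (fun v hv x => (hD1 _).trans (hle v hv x)) (fun v hv x => (hD2 _).trans (hle v hv x))
  refine ⟨h1, h2, h3, ?_⟩
  set A := ∫ x, w (y + a • x) ∂(stdGaussian E)
  set B := Module.finrank ℝ E * c * (K * (1 + 2 * K) * A)
  have hΔ : ∀ v ∈ Set.Icc 0 a,
      |∫ x, Laplacian.laplacian g (y + v • x) ∂(stdGaussian E)| ≤ B := fun v hv => by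
    obtain ⟨k1, k2⟩ := hw.integral_smul_le y hv hi
    have hb : ∀ x, ‖Laplacian.laplacian g (y + v • x)‖
        ≤ Module.finrank ℝ E * c * w (y + v • x) := fun x => by
      rw [Real.norm_eq_abs, mul_assoc]
      exact (abs_laplacian_le _).trans (by gcongr; exact hD2 _)
    have h := norm_integral_le_of_norm_le (k1.const_mul (Module.finrank ℝ E * c))
      (Filter.Eventually.of_forall hb)
    rw [integral_const_mul] at h
    exact h.trans (mul_le_mul_of_nonneg_left k2 (mul_nonneg (Nat.cast_nonneg _) hc))
  have ha : 0 ≤ a := hu.1.trans hu.2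
  have hB : 0 ≤ B := (abs_nonneg _).trans (hΔ 0 ⟨le_rfl, ha⟩)
  rw [h3, add_sub_cancel_left]
  have h := intervalIntegral.norm_integral_le_of_norm_le_const (a := 0) (b := u) (C := a * B)
    (f := fun v => v * ∫ x, Laplacian.laplacian g (y + v • x) ∂(stdGaussian E)) (fun v hv => by
      rw [Set.uIoc_of_le hu.1] at hv
      rw [norm_mul, Real.norm_of_nonneg hv.1.le]
      exact mul_le_mul (hv.2.trans hu.2) (hΔ v ⟨hv.1.le, hv.2.trans hu.2⟩) (norm_nonneg _) ha)
  rw [Real.norm_eq_abs] at h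
  refine h.trans ?_
  rw [sub_zero, abs_of_nonneg hu.1]
  nlinarith [mul_le_mul_of_nonneg_left hu.2 (mul_nonneg ha hB)]

/-- Second order expansion of a Gaussian average in the variance. -/
theorem abs_integral_sub_laplacian_le (hw : IsWeight w K) {ψ : E → ℝ} {c : ℝ}
    (hψ : IsDominated w c ψ) (y : E) {a : ℝ}
    (ha : 0 ≤ a) (hint : MemLp (fun x => w (y + a • x)) 2 (stdGaussian E)) :
    |∫ x, ψ (y + a • x) ∂(stdGaussian E) - ψ y - a ^ 2 / 2 * Laplacian.laplacian ψ y|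
      ≤ a ^ 4 * (Module.finrank ℝ E * c * (K * (1 + 2 * K)
        * ∫ x, w (y + a • x) ∂(stdGaussian E))) := by
  obtain ⟨-, h2, h3, -⟩ := hw.abs_integral_sub_le hψ.nonneg hψ.contDiff hψ.fderiv_le
    hψ.iteratedFDeriv_le y ⟨ha, le_rfl⟩ hint
  set B := Module.finrank ℝ E * c * (K * (1 + 2 * K) * ∫ x, w (y + a • x) ∂(stdGaussian E))
  have hlap : ∀ u ∈ Set.Icc 0 a,
      |∫ x, Laplacian.laplacian ψ (y + u • x) ∂(stdGaussian E) - Laplacian.laplacian ψ y|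
        ≤ a ^ 2 * B := fun u hu =>
    (hw.abs_integral_sub_le hψ.nonneg hψ.contDiff_laplacian hψ.fderiv_laplacian_le
      hψ.iteratedFDeriv_laplacian_le y hu hint).2.2.2
  -- Since `∫₀ᵃ u du = a² / 2`, freezing the Laplacian at `y` in the heat formula gives the
  -- second-order term. The error is the heat formula once more, for `Δψ`, so no fourth derivative
  -- of `ψ` appears.
  have e : ∫ x, ψ (y + a • x) ∂(stdGaussian E) - ψ y - a ^ 2 / 2 * Laplacian.laplacian ψ y
      = ∫ u in (0 : ℝ)..a, u * (∫ x, Laplacian.laplacian ψ (y + u • x) ∂(stdGaussian E)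
        - Laplacian.laplacian ψ y) := by
    simp_rw [mul_sub]
    rw [intervalIntegral.integral_sub h2
      ((by fun_prop : Continuous fun u : ℝ => u * Laplacian.laplacian ψ y).intervalIntegrable _ _),
      intervalIntegral.integral_mul_const, integral_id, h3]
    ring
  rw [e]
  have h := intervalIntegral.norm_integral_le_of_norm_le_const (a := 0) (b := a)
    (C := a * (a ^ 2 * B))
    (f := fun u => u * (∫ x, Laplacian.laplacian ψ (y + u • x) ∂(stdGaussian E)
        - Laplacian.laplacian ψ y)) (fun v hv => by
      rw [Set.uIoc_of_le ha] at hv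
      rw [norm_mul, Real.norm_of_nonneg hv.1.le]
      exact mul_le_mul hv.2 (hlap v ⟨hv.1.le, hv.2⟩) (norm_nonneg _) ha)
  rw [Real.norm_eq_abs, sub_zero, abs_of_nonneg ha] at h
  exact h.trans (le_of_eq (by ring))

/-- The conditional bias of one step of the discretized Langevin dynamics. -/
theorem abs_integral_step_sub_le (hw : IsWeight w K) {ψ : E → ℝ} {c : ℝ}
    (hψ : IsDominated w c ψ) {x G : E}
    (hG : IsDriftDominated w c ψ x G) {h : ℝ} (hh : 0 ≤ h)
    (hint : MemLp (fun ξ => w (x + (h / 2) • G + √h • ξ)) 2 (stdGaussian E)) :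
    |∫ ξ, ψ (x + (h / 2) • G + √h • ξ) ∂(stdGaussian E) - ψ x
        - h / 2 * (fderiv ℝ ψ x G + Laplacian.laplacian ψ x)|
      ≤ h ^ 2 * ((Module.finrank ℝ E + 2) * c * (1 + K) * (1 + 2 * K)
        * (w x + ∫ ξ, w (x + (h / 2) • G + √h • ξ) ∂(stdGaussian E))) := by
  set y := x + (h / 2) • G with hy
  set A := ∫ ξ, w (y + √h • ξ) ∂(stdGaussian E)
  have hi := hint.integrable (by norm_num)
  have hK := hw.K_nonneg
  have hc := hψ.nonneg
  have hwx := hw.one_le x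
  have hwy : w y ≤ 2 * K * A := hw.le_two_mul_integral y _ hi
  have hA : 0 ≤ A := integral_nonneg fun ξ => zero_le_one.trans (hw.one_le _)
  have hseg : ∀ z ∈ _root_.segment ℝ x y, c * (w z + w x) ≤ c * ((1 + K) * (w x + 2 * K * A)) := by
    intro z hz
    have h1 := hw.le_of_mem_segment hz
    refine mul_le_mul_of_nonneg_left ?_ hc
    nlinarith [mul_le_mul_of_nonneg_left hwy hK, mul_nonneg hK hA]
  have hnorm : ‖(h / 2) • G‖ = h / 2 * ‖G‖ := by
    rw [norm_smul, Real.norm_of_nonneg (by positivity)]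
  set Q := c * ((1 + K) * (w x + 2 * K * A)) with hQ
  have hQ0 : 0 ≤ Q := by positivity
  have h1 := hw.abs_integral_sub_laplacian_le hψ y (Real.sqrt_nonneg h) hint
  have h2 := abs_taylor_two_le_of_iteratedFDeriv_mul_norm_le hψ.contDiff x ((h / 2) • G)
    (N := (h / 2) ^ 2 * Q) (fun z hz => by
      rw [hnorm, mul_pow, mul_left_comm]
      gcongr
      exact (hG.iteratedFDeriv_mul_le z).trans (hseg z hz))
  have h3 := abs_sub_le_of_fderiv_mul_norm_le (hψ.contDiff_laplacian.differentiable (by norm_num))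
    x ((h / 2) • G) (N := (h / 2) * Q) (fun z hz => by
      rw [hnorm, mul_left_comm]
      gcongr
      exact (hG.fderiv_laplacian_mul_le z).trans (hseg z hz))
  rw [← hy] at h2 h3
  have e2 : √h ^ 2 = h := Real.sq_sqrt hh
  have e4 : √h ^ 4 = h ^ 2 := by rw [show (4 : ℕ) = 2 * 2 from rfl, pow_mul, e2]
  rw [e2, e4] at h1
  rw [map_smul, smul_eq_mul] at h2
  set n : ℝ := (Module.finrank ℝ E : ℝ)
  have hn : 0 ≤ n := Nat.cast_nonneg _
  set Z := c * ((1 + K) * (1 + 2 * K)) * (w x + A) with hZ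
  have hZ0 : 0 ≤ Z := by positivity
  have hQZ : Q ≤ Z := by
    have k : w x + 2 * K * A ≤ (1 + 2 * K) * (w x + A) := by
      nlinarith only [mul_nonneg hK (zero_le_one.trans hwx), hA]
    calc Q ≤ c * ((1 + K) * ((1 + 2 * K) * (w x + A))) := by rw [hQ]; gcongr
      _ = Z := by rw [hZ]; ring
  have hBZ : n * c * (K * (1 + 2 * K) * A) ≤ n * Z := by
    rw [hZ, mul_assoc n c, mul_assoc c]
    gcongr <;> linarith
  have h3' : |h / 2 * (Laplacian.laplacian ψ y - Laplacian.laplacian ψ x)|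
      ≤ h / 2 * (h / 2 * Q) := by
    rw [abs_mul, abs_of_nonneg (by positivity : 0 ≤ h / 2)]
    gcongr
  -- Three errors, each `O(h²)`: the Gaussian expansion at the drifted point `y`, the Taylor
  -- expansion of `ψ` from `x` to `y`, and the change of `Δψ` from `x` to `y`.
  have e : ∫ ξ, ψ (y + √h • ξ) ∂(stdGaussian E) - ψ x
        - h / 2 * (fderiv ℝ ψ x G + Laplacian.laplacian ψ x)
      = (∫ ξ, ψ (y + √h • ξ) ∂(stdGaussian E) - ψ y - h / 2 * Laplacian.laplacian ψ y)
        + (ψ y - ψ x - h / 2 * fderiv ℝ ψ x G)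
        + h / 2 * (Laplacian.laplacian ψ y - Laplacian.laplacian ψ x) := by ring
  rw [e]
  calc _ ≤ h ^ 2 * (n * c * (K * (1 + 2 * K) * A)) + (h / 2) ^ 2 * Q + h / 2 * (h / 2 * Q) :=
        (abs_add_three _ _ _).trans (add_le_add (add_le_add h1 h2) h3')
    _ = h ^ 2 * (n * c * (K * (1 + 2 * K) * A) + Q / 2) := by ring
    _ ≤ h ^ 2 * (n * Z + 2 * Z) := by gcongr; linarith
    _ = _ := by rw [hZ]; ring

/-- The mean square displacement of `ψ` along one step of the discretized Langevin dynamics. -/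
theorem integral_step_sub_sq_le (hw : IsWeight w K) {ψ : E → ℝ} {c : ℝ} (hψ : IsDominated w c ψ) :
    ∃ C : ℝ, 0 ≤ C ∧ ∀ (x G : E), IsDriftDominated w c ψ x G → ∀ h : ℝ, 0 ≤ h → h ≤ 1 →
    MemLp (fun ξ => w (x + (h / 2) • G + √h • ξ)) 2 (stdGaussian E) →
    ∫ ξ, (ψ (x + (h / 2) • G + √h • ξ) - ψ x) ^ 2 ∂(stdGaussian E)
      ≤ h * (C * (w x ^ 2 + ∫ ξ, w (x + (h / 2) • G + √h • ξ) ^ 2 ∂(stdGaussian E))) := by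
  have hK := hw.K_nonneg
  have hc := hψ.nonneg
  set n : ℝ := (Module.finrank ℝ E : ℝ) with hn
  set p : ℝ := (gaussianPoincareConst E).toReal with hp
  have hp0 : 0 ≤ p := ENNReal.toReal_nonneg
  -- The displacement splits into fluctuation, Gaussian bias and drift. The factors `3` come from
  -- the square of a three-term sum, and `6` from a further `(w x + A)² ≤ 2 (w x² + A₂)` in the
  -- drift.
  refine ⟨3 * p * c ^ 2 + 3 * (n * c * (K * (1 + 2 * K))) ^ 2
    + 6 * (c * ((1 + K) * (1 + 2 * K))) ^ 2, by positivity, fun x G hG h hh h1 hint => ?_⟩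
  set y := x + (h / 2) • G with hy
  set A := ∫ ξ, w (y + √h • ξ) ∂(stdGaussian E) with hA
  set A₂ := ∫ ξ, w (y + √h • ξ) ^ 2 ∂(stdGaussian E) with hA₂
  have hi := hint.integrable (by norm_num)
  have hi2 := hint.integrable_sq
  have hA0 : 0 ≤ A := integral_nonneg fun ξ => zero_le_one.trans (hw.one_le _)
  have hA₂0 : 0 ≤ A₂ := integral_nonneg fun ξ => sq_nonneg _
  have hjensen : A ^ 2 ≤ A₂ := by
    have h := variance_nonneg (fun ξ => w (y + √h • ξ)) (stdGaussian E)
    rw [variance_eq_sub hint] at h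
    simpa using h
  have hwx := hw.one_le x
  have hwy : w y ≤ 2 * K * A := hw.le_two_mul_integral y _ hi
  obtain ⟨hψi, -, -, hbias⟩ := hw.abs_integral_sub_le hψ.nonneg hψ.contDiff hψ.fderiv_le
    hψ.iteratedFDeriv_le y ⟨Real.sqrt_nonneg h, le_rfl⟩ hint
  rw [Real.sq_sqrt hh] at hbias
  set m := ∫ ξ, ψ (y + √h • ξ) ∂(stdGaussian E) with hm
  have hψc := hψ.contDiff.continuous
  -- fluctuation around the mean
  have hcd : ContDiff ℝ 1 (fun ξ => ψ (y + √h • ξ)) :=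
    (hψ.contDiff.of_le (by norm_num)).comp (by fun_prop)
  have hfd : ∀ ξ, ‖fderiv ℝ (fun ξ => ψ (y + √h • ξ)) ξ‖ ≤ √h * c * w (y + √h • ξ) := fun ξ => by
    have h1 : HasFDerivAt (fun ξ : E => y + √h • ξ) (√h • ContinuousLinearMap.id ℝ E) ξ :=
      ((hasFDerivAt_id ξ).const_smul (√h)).const_add y
    have h2 : HasFDerivAt (fun ξ => ψ (y + √h • ξ)) _ ξ :=
      (hψ.contDiff.differentiable (by norm_num) _).hasFDerivAt.comp ξ h1
    rw [h2.fderiv, ContinuousLinearMap.comp_smul, ContinuousLinearMap.comp_id, norm_smul,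
      Real.norm_of_nonneg (Real.sqrt_nonneg h), mul_assoc]
    gcongr
    exact hψ.fderiv_le _
  -- The factor `h` is the square of the scale `√h` in the derivative. Working with `∫⁻` makes this
  -- bound also yield the integrability of the square.
  have hvarL : ∫⁻ ξ, ‖ψ (y + √h • ξ) - m‖ₑ ^ 2 ∂(stdGaussian E)
      ≤ ENNReal.ofReal (p * (h * c ^ 2 * A₂)) := by
    refine (lintegral_sub_integral_sq_stdGaussian_le hcd hψi).trans ?_
    rw [ENNReal.ofReal_mul hp0, hp, ENNReal.ofReal_toReal gaussianPoincareConst_ne_top,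
      hA₂, ← integral_const_mul, ofReal_integral_eq_lintegral_ofReal (hi2.const_mul _)
        (Filter.Eventually.of_forall fun ξ => by positivity)]
    gcongr with ξ
    rw [← ofReal_norm, ← ENNReal.ofReal_pow (norm_nonneg _)]
    refine ENNReal.ofReal_le_ofReal ?_
    calc _ ≤ (√h * c * w (y + √h • ξ)) ^ 2 := by gcongr; exact hfd ξ
      _ = _ := by rw [mul_pow, mul_pow, Real.sq_sqrt hh]
  have hsq : ∀ ξ, ‖ψ (y + √h • ξ) - m‖ₑ ^ 2
      = ENNReal.ofReal ((ψ (y + √h • ξ) - m) ^ 2) := fun ξ => by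
    rw [← ofReal_norm, ← ENNReal.ofReal_pow (norm_nonneg _), Real.norm_eq_abs, sq_abs]
  simp_rw [hsq] at hvarL
  have hmeas : AEStronglyMeasurable (fun ξ => (ψ (y + √h • ξ) - m) ^ 2) (stdGaussian E) :=
    Continuous.aestronglyMeasurable (by fun_prop)
  have hvi : Integrable (fun ξ => (ψ (y + √h • ξ) - m) ^ 2) (stdGaussian E) := by
    refine ⟨hmeas, ?_⟩
    rw [hasFiniteIntegral_iff_ofReal (Filter.Eventually.of_forall fun ξ => sq_nonneg _)]
    exact hvarL.trans_lt ENNReal.ofReal_lt_top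
  have hvar : ∫ ξ, (ψ (y + √h • ξ) - m) ^ 2 ∂(stdGaussian E) ≤ p * (h * c ^ 2 * A₂) := by
    rw [integral_eq_lintegral_of_nonneg_ae (Filter.Eventually.of_forall fun ξ => sq_nonneg _) hmeas]
    exact ENNReal.toReal_le_of_le_ofReal (by positivity) hvarL
  -- the drift
  have hnorm : ‖(h / 2) • G‖ = h / 2 * ‖G‖ := by
    rw [norm_smul, Real.norm_of_nonneg (by positivity)]
  have hdrift : |ψ y - ψ x| ≤ h * (c * ((1 + K) * (1 + 2 * K)) * (w x + A)) := by
    refine abs_sub_le_of_fderiv_mul_norm_le (hψ.contDiff.differentiable (by norm_num)) x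
      ((h / 2) • G) (fun z hz => ?_)
    have k1 := hw.le_of_mem_segment hz
    rw [← hy] at k1
    rw [hnorm, mul_left_comm]
    have k2 : w z + w x ≤ (1 + K) * (1 + 2 * K) * (w x + A) := by
      have := mul_le_mul_of_nonneg_left hwy hK
      nlinarith [mul_nonneg hK hA0, mul_nonneg hK (zero_le_one.trans hwx),
        mul_nonneg hK (mul_nonneg hK hA0), mul_nonneg hK (mul_nonneg hK (zero_le_one.trans hwx))]
    calc h / 2 * (‖fderiv ℝ ψ z‖ * ‖G‖) ≤ h * (c * (w z + w x)) :=
          mul_le_mul (by linarith) (hG.fderiv_mul_le z) (by positivity) hh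
      _ ≤ _ := by rw [mul_assoc c]; gcongr
  -- assembling
  have hd := pow_le_pow_left₀ (abs_nonneg _) hdrift 2
  have hb := pow_le_pow_left₀ (abs_nonneg _) hbias 2
  rw [sq_abs] at hd hb
  have hhh : h ^ 2 ≤ h := by nlinarith
  have hpt : ∀ ξ, (ψ (y + √h • ξ) - ψ x) ^ 2
      ≤ 3 * (ψ (y + √h • ξ) - m) ^ 2 + (3 * (m - ψ y) ^ 2 + 3 * (ψ y - ψ x) ^ 2) := fun ξ => by
    nlinarith [sq_nonneg ((ψ (y + √h • ξ) - m) - (m - ψ y)), sq_nonneg ((m - ψ y) - (ψ y - ψ x)),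
      sq_nonneg ((ψ (y + √h • ξ) - m) - (ψ y - ψ x))]
  have hfin := integral_mono_of_nonneg (Filter.Eventually.of_forall fun ξ => sq_nonneg _)
    ((hvi.const_mul 3).add (integrable_const (3 * (m - ψ y) ^ 2 + 3 * (ψ y - ψ x) ^ 2)))
    (Filter.Eventually.of_forall hpt)
  refine hfin.trans ?_
  simp only [Pi.add_apply]
  rw [integral_add (hvi.const_mul 3) (integrable_const _), integral_const_mul, integral_const]
  simp only [probReal_univ, one_smul]
  have hb' : (m - ψ y) ^ 2 ≤ h * ((n * c * (K * (1 + 2 * K))) ^ 2 * A₂) := by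
    refine hb.trans ?_
    calc _ = h ^ 2 * ((n * c * (K * (1 + 2 * K))) ^ 2 * A ^ 2) := by ring
      _ ≤ _ := by gcongr
  have hd' : (ψ y - ψ x) ^ 2
      ≤ h * ((c * ((1 + K) * (1 + 2 * K))) ^ 2 * (2 * (w x ^ 2 + A₂))) := by
    refine hd.trans ?_
    have k : (w x + A) ^ 2 ≤ 2 * (w x ^ 2 + A₂) := by nlinarith only [sq_nonneg (w x - A), hjensen]
    rw [mul_pow, mul_pow _ (w x + A)]
    gcongr
  -- Padding terms: they let `w x ^ 2` and `A₂` carry the same constant.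
  have hz1 : 0 ≤ h * (p * c ^ 2 * w x ^ 2) := by positivity
  have hz2 : 0 ≤ h * ((n * c * (K * (1 + 2 * K))) ^ 2 * w x ^ 2) := by positivity
  refine le_of_le_of_eq (b := 3 * (p * (h * c ^ 2 * A₂))
    + (3 * (h * ((n * c * (K * (1 + 2 * K))) ^ 2 * A₂))
      + 3 * (h * ((c * ((1 + K) * (1 + 2 * K))) ^ 2 * (2 * (w x ^ 2 + A₂)))))
    + 3 * (h * (p * c ^ 2 * w x ^ 2))
    + 3 * (h * ((n * c * (K * (1 + 2 * K))) ^ 2 * w x ^ 2))) ?_ (by ring)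
  linarith

end IsWeight

end OneStep

/-! ### Mean square ergodic averages of a noise-driven chain, given one-step bounds. -/

section MarkovChain

variable {Ω E Z : Type*} [mΩ : MeasurableSpace Ω] [MeasurableSpace E] [MeasurableSpace Z]

/-- The process `θ` is the Markov chain driven by the update rule `F` and by noise `z` with
law `ζ`, where the noise of each step is independent of the past `𝓕`. -/
structure IsNoiseDriven (P : Measure Ω) (ζ : Measure Z) (F : E → Z → E) (𝓕 : Filtration ℕ mΩ)
    (θ : ℕ → Ω → E) (z : ℕ → Ω → Z) : Prop where
  measurable_update : Measurable (Function.uncurry F)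
  measurable_state : ∀ t, Measurable[𝓕 t] (θ t)
  measurable_noise : ∀ t, Measurable (z t)
  law : ∀ t, P.map (z t) = ζ
  indep : ∀ t, Indep (𝓕 t) (MeasurableSpace.comap (z t) inferInstance) P
  step : ∀ t ω, θ (t + 1) ω = F (θ t ω) (z t ω)

namespace IsNoiseDriven

variable {P : Measure Ω} {ζ : Measure Z} {F : E → Z → E} {𝓕 : Filtration ℕ mΩ} {θ : ℕ → Ω → E}
  {z : ℕ → Ω → Z} {w ψ L : E → ℝ} {C₁ C₂ C₃ K h : ℝ}

theorem measurable_chain (hM : IsNoiseDriven P ζ F 𝓕 θ z) (t : ℕ) : Measurable (θ t) :=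
  (hM.measurable_state t).mono (𝓕.le t) le_rfl

theorem memLp_of_abs_le {P : Measure Ω} {f : E → ℝ} {w : E → ℝ} {C : ℝ} (hf : Measurable f)
    {X : Ω → E} (hX : Measurable X) (hw : Measurable w)
    (hle : ∀ x, |f x| ≤ C * w x) (hint : Integrable (fun ω => w (X ω) ^ 2) P) :
    MemLp (fun ω => f (X ω)) 2 P := by
  have h1 : MemLp (fun ω => w (X ω)) 2 P :=
    (memLp_two_iff_integrable_sq (hw.comp hX).aestronglyMeasurable).2 hint
  refine (h1.const_mul C).mono' (hf.comp hX).aestronglyMeasurable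
    (Filter.Eventually.of_forall fun ω => ?_)
  exact hle _

/-- Cauchy–Schwarz, with no cancellation between times. This suffices for the bias, whose terms are
already of size `h²`. -/
theorem integral_sum_sq_le {f : ℕ → Ω → ℝ} {A : ℝ} (hf : ∀ t, MemLp (f t) 2 P)
    (hA : ∀ t, ∫ ω, f t ω ^ 2 ∂P ≤ A) (T : ℕ) :
    MemLp (fun ω => ∑ t ∈ Finset.range T, f t ω) 2 P ∧
    ∫ ω, (∑ t ∈ Finset.range T, f t ω) ^ 2 ∂P ≤ T ^ 2 * A := by
  have hS : MemLp (fun ω => ∑ t ∈ Finset.range T, f t ω) 2 P :=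
    memLp_finsetSum _ fun t _ => hf t
  refine ⟨hS, ?_⟩
  calc _ ≤ ∫ ω, T * ∑ t ∈ Finset.range T, f t ω ^ 2 ∂P := by
        refine integral_mono hS.integrable_sq
          ((integrable_finsetSum _ fun t _ => (hf t).integrable_sq).const_mul _) fun ω => ?_
        simpa using sq_sum_le_card_mul_sum_sq (s := Finset.range T) (f := fun t => f t ω)
    _ = T * ∑ t ∈ Finset.range T, ∫ ω, f t ω ^ 2 ∂P := by
        rw [integral_const_mul, integral_finsetSum _ fun t _ => (hf t).integrable_sq]
    _ ≤ T * ∑ t ∈ Finset.range T, A := by gcongr; exact hA _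
    _ = T ^ 2 * A := by simp; ring

variable [IsProbabilityMeasure ζ]

theorem measurable_integral_update (hM : IsNoiseDriven P ζ F 𝓕 θ z) (hψm : Measurable ψ) :
    Measurable (fun x => ∫ s, ψ (F x s) ∂ζ) :=
  ((hψm.comp hM.measurable_update).stronglyMeasurable.integral_prod_right').measurable

theorem measurable_increment (hM : IsNoiseDriven P ζ F 𝓕 θ z) (hψm : Measurable ψ) (t : ℕ) :
    Measurable[𝓕 (t + 1)] (fun ω => ψ (θ (t + 1) ω) - ∫ s, ψ (F (θ t ω) s) ∂ζ) :=
  (hψm.comp (hM.measurable_state (t + 1))).sub ((hM.measurable_integral_update hψm).comp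
    ((hM.measurable_state t).mono (𝓕.mono t.le_succ) le_rfl))

variable [IsProbabilityMeasure P]

/-- Integrating out the noise of one step. -/
theorem integral_noise (hM : IsNoiseDriven P ζ F 𝓕 θ z)
    {α : Type*} [MeasurableSpace α] (t : ℕ) {X : Ω → α}
    (hX : Measurable[𝓕 t] X) {f : α × Z → ℝ} (hf : Measurable f)
    (hint : Integrable (fun ω => f (X ω, z t ω)) P) :
    (∀ᵐ ω ∂P, Integrable (fun s => f (X ω, s)) ζ) ∧
    Integrable (fun ω => ∫ s, f (X ω, s) ∂ζ) P ∧
    ∫ ω, f (X ω, z t ω) ∂P = ∫ ω, ∫ s, f (X ω, s) ∂ζ ∂P := by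
  have hX' : Measurable X := hX.mono (𝓕.le t) le_rfl
  have hind : IndepFun X (z t) P :=
    (IndepFun_iff_Indep _ _ _).2 (indep_of_indep_of_le_left (hM.indep t) hX.comap_le)
  have hmap : P.map (fun ω => (X ω, z t ω)) = (P.map X).prod ζ := by
    rw [← hM.law t]
    exact (indepFun_iff_map_prod_eq_prod_map_map hX'.aemeasurable
      (hM.measurable_noise t).aemeasurable).1 hind
  have hpair : Measurable (fun ω => (X ω, z t ω)) := hX'.prodMk (hM.measurable_noise t)
  have : IsProbabilityMeasure (P.map X) := Measure.isProbabilityMeasure_map hX'.aemeasurable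
  have hint' : Integrable f ((P.map X).prod ζ) := by
    rw [← hmap, integrable_map_measure hf.aestronglyMeasurable hpair.aemeasurable]
    exact hint
  refine ⟨ae_of_ae_map hX'.aemeasurable hint'.prod_right_ae,
    hint'.integral_prod_left.comp_measurable hX', ?_⟩
  have h1 : ∫ ω, f (X ω, z t ω) ∂P = ∫ q, f q ∂((P.map X).prod ζ) := by
    rw [← hmap, integral_map hpair.aemeasurable hf.aestronglyMeasurable]
  rw [h1, integral_prod _ hint', integral_map hX'.aemeasurable
    hint'.integral_prod_left.aestronglyMeasurable]

/-- The moment bound at time `t + 1`, disintegrated over the state at time `t`. The one-step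
estimates assume integrability at a given state; this supplies it at almost every visited state. -/
theorem integral_weight_update (hM : IsNoiseDriven P ζ F 𝓕 θ z) (hwm : Measurable w)
    (hmom : ∀ t, Integrable (fun ω => w (θ t ω) ^ 2) P ∧ ∫ ω, w (θ t ω) ^ 2 ∂P ≤ K)
    (t : ℕ) :
    (∀ᵐ ω ∂P, Integrable (fun s => w (F (θ t ω) s) ^ 2) ζ) ∧
    Integrable (fun ω => w (θ t ω) ^ 2 + ∫ s, w (F (θ t ω) s) ^ 2 ∂ζ) P ∧
    ∫ ω, (w (θ t ω) ^ 2 + ∫ s, w (F (θ t ω) s) ^ 2 ∂ζ) ∂P ≤ 2 * K := by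
  have hf : Measurable (fun q : E × Z => w (F q.1 q.2) ^ 2) :=
    (hwm.comp hM.measurable_update).pow_const 2
  have hi := (hmom (t + 1)).1
  simp_rw [hM.step] at hi
  obtain ⟨h1, h2, h3⟩ := hM.integral_noise t (hM.measurable_state t) hf hi
  refine ⟨h1, (hmom t).1.add h2, ?_⟩
  rw [integral_add (hmom t).1 h2, ← h3]
  have h4 := (hmom (t + 1)).2
  simp_rw [hM.step] at h4
  linarith [(hmom t).2]

theorem memLp_increment (hM : IsNoiseDriven P ζ F 𝓕 θ z) (hwm : Measurable w) (hψm : Measurable ψ)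
    (hψ : ∀ x, |ψ x| ≤ C₁ * w x)
    (hmom : ∀ t, Integrable (fun ω => w (θ t ω) ^ 2) P ∧ ∫ ω, w (θ t ω) ^ 2 ∂P ≤ K)
    (t : ℕ) :
    MemLp (fun ω => ψ (θ (t + 1) ω) - ∫ s, ψ (F (θ t ω) s) ∂ζ) 2 P := by
  refine (memLp_of_abs_le hψm (hM.measurable_chain _) hwm hψ (hmom (t + 1)).1).sub ?_
  have hmeas := (hM.measurable_integral_update hψm).comp (hM.measurable_chain t)
  refine (memLp_two_iff_integrable_sq hmeas.aestronglyMeasurable).2 ?_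
  obtain ⟨h1, h2, -⟩ := hM.integral_weight_update hwm hmom t
  refine (h2.const_mul (C₁ ^ 2)).mono' (hmeas.pow_const 2).aestronglyMeasurable ?_
  filter_upwards [h1] with ω hω
  have hmF : Measurable (F (θ t ω)) := hM.measurable_update.comp measurable_prodMk_left
  have hv := variance_nonneg (fun s => ψ (F (θ t ω) s)) ζ
  rw [variance_eq_sub (memLp_of_abs_le hψm hmF hwm hψ hω)] at hv
  have hle : ∫ s, ψ (F (θ t ω) s) ^ 2 ∂ζ ≤ ∫ s, C₁ ^ 2 * w (F (θ t ω) s) ^ 2 ∂ζ := by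
    refine integral_mono (memLp_of_abs_le hψm hmF hwm hψ hω).integrable_sq (hω.const_mul _)
      fun s => ?_
    have := pow_le_pow_left₀ (abs_nonneg _) (hψ (F (θ t ω) s)) 2
    rwa [sq_abs, mul_pow] at this
  rw [integral_const_mul] at hle
  simp only [Pi.pow_apply, Function.comp_apply, Real.norm_eq_abs, abs_pow, sq_abs] at hv ⊢
  nlinarith [mul_nonneg (sq_nonneg C₁) (sq_nonneg (w (θ t ω)))]

/-- Martingale orthogonality: given the past, `S` and `θ t` are fixed, and averaging over the fresh
noise kills the centred increment. -/
theorem integral_mul_increment_eq_zero (hM : IsNoiseDriven P ζ F 𝓕 θ z) (hwm : Measurable w)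
    (hψm : Measurable ψ) (hψ : ∀ x, |ψ x| ≤ C₁ * w x)
    (hmom : ∀ t, Integrable (fun ω => w (θ t ω) ^ 2) P ∧ ∫ ω, w (θ t ω) ^ 2 ∂P ≤ K)
    (t : ℕ) {S : Ω → ℝ} (hS : Measurable[𝓕 t] S)
    (hS2 : MemLp S 2 P) :
    ∫ ω, S ω * (ψ (θ (t + 1) ω) - ∫ s, ψ (F (θ t ω) s) ∂ζ) ∂P = 0 := by
  have hint := hS2.integrable_mul (hM.memLp_increment hwm hψm hψ hmom t)
  have hf : Measurable (fun q : (ℝ × E) × Z =>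
      q.1.1 * (ψ (F q.1.2 q.2) - ∫ s, ψ (F q.1.2 s) ∂ζ)) := by
    have h1 : Measurable (fun q : (ℝ × E) × Z => ψ (F q.1.2 q.2)) :=
      (hψm.comp hM.measurable_update).comp (by fun_prop : Measurable
        fun q : (ℝ × E) × Z => (q.1.2, q.2))
    have h2 : Measurable (fun q : (ℝ × E) × Z => ∫ s, ψ (F q.1.2 s) ∂ζ) :=
      (hM.measurable_integral_update hψm).comp (by fun_prop)
    exact (by fun_prop : Measurable fun q : (ℝ × E) × Z => q.1.1).mul (h1.sub h2)
  have hX : Measurable[𝓕 t] (fun ω => (S ω, θ t ω)) := hS.prodMk (hM.measurable_state t)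
  have hint' : Integrable (fun ω => S ω * (ψ (F (θ t ω) (z t ω))
      - ∫ s, ψ (F (θ t ω) s) ∂ζ)) P := by
    simpa only [Pi.mul_def, hM.step] using hint
  obtain ⟨-, -, h3⟩ := hM.integral_noise t hX hf hint'
  simp_rw [hM.step]
  refine h3.trans (integral_eq_zero_of_ae ?_)
  filter_upwards [(hM.integral_weight_update hwm hmom t).1] with ω hω
  have hmF : Measurable (F (θ t ω)) := hM.measurable_update.comp measurable_prodMk_left
  have hi := (memLp_of_abs_le hψm hmF hwm hψ hω).integrable (by norm_num)
  rw [integral_const_mul, integral_sub hi (integrable_const _)]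
  simp

/-- Conditionally on the state, the increment is centred at its mean, and a variance is at most the
second moment about any other point, here `ψ (θ t)`. -/
theorem integral_increment_sq_le (hM : IsNoiseDriven P ζ F 𝓕 θ z) (hwm : Measurable w)
    (hψm : Measurable ψ) (hψ : ∀ x, |ψ x| ≤ C₁ * w x)
    (hmom : ∀ t, Integrable (fun ω => w (θ t ω) ^ 2) P ∧ ∫ ω, w (θ t ω) ^ 2 ∂P ≤ K)
    (hdisp : ∀ x, Integrable (fun s => w (F x s) ^ 2) ζ →
      ∫ s, (ψ (F x s) - ψ x) ^ 2 ∂ζ ≤ h * (C₃ * (w x ^ 2 + ∫ s, w (F x s) ^ 2 ∂ζ)))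
    (hh : 0 ≤ h) (hC₃ : 0 ≤ C₃) (t : ℕ) :
    ∫ ω, (ψ (θ (t + 1) ω) - ∫ s, ψ (F (θ t ω) s) ∂ζ) ^ 2 ∂P ≤ h * (C₃ * (2 * K)) := by
  have hint := (hM.memLp_increment hwm hψm hψ hmom t).integrable_sq
  have hf : Measurable (fun q : E × Z => (ψ (F q.1 q.2) - ∫ s, ψ (F q.1 s) ∂ζ) ^ 2) := by
    have h1 : Measurable (fun q : E × Z => ψ (F q.1 q.2)) := hψm.comp hM.measurable_update
    have h2 : Measurable (fun q : E × Z => ∫ s, ψ (F q.1 s) ∂ζ) :=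
      (hM.measurable_integral_update hψm).comp (by fun_prop)
    exact (h1.sub h2).pow_const 2
  simp_rw [hM.step] at hint ⊢
  obtain ⟨-, h2, h3⟩ := hM.integral_noise t (hM.measurable_state t) hf hint
  obtain ⟨k1, k2, k3⟩ := hM.integral_weight_update hwm hmom t
  refine h3.le.trans ?_
  calc _ ≤ ∫ ω, h * (C₃ * (w (θ t ω) ^ 2 + ∫ s, w (F (θ t ω) s) ^ 2 ∂ζ)) ∂P := by
        refine integral_mono_ae h2 ((k2.const_mul _).const_mul _) ?_
        filter_upwards [k1] with ω hω
        refine le_trans ?_ (hdisp _ hω)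
        have hmF : Measurable (F (θ t ω)) := hM.measurable_update.comp measurable_prodMk_left
        have hm2 := memLp_of_abs_le hψm hmF hwm hψ hω
        have hm3 : MemLp (fun s => ψ (F (θ t ω) s) - ψ (θ t ω)) 2 ζ := hm2.sub (memLp_const _)
        have hv := variance_le_expectation_sq hm3.aestronglyMeasurable
        rw [variance_sub_const hm2.aestronglyMeasurable,
          variance_eq_integral hm2.aemeasurable] at hv
        simpa using hv
    _ ≤ _ := by
        rw [integral_const_mul, integral_const_mul]
        gcongr

/-- Orthogonality makes the second moments add, so the growth is linear in `T` rather than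
quadratic. -/
theorem integral_sum_increment_sq_le (hM : IsNoiseDriven P ζ F 𝓕 θ z) (hwm : Measurable w)
    (hψm : Measurable ψ) (hψ : ∀ x, |ψ x| ≤ C₁ * w x)
    (hmom : ∀ t, Integrable (fun ω => w (θ t ω) ^ 2) P ∧ ∫ ω, w (θ t ω) ^ 2 ∂P ≤ K)
    (hdisp : ∀ x, Integrable (fun s => w (F x s) ^ 2) ζ →
      ∫ s, (ψ (F x s) - ψ x) ^ 2 ∂ζ ≤ h * (C₃ * (w x ^ 2 + ∫ s, w (F x s) ^ 2 ∂ζ)))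
    (hh : 0 ≤ h) (hC₃ : 0 ≤ C₃) (T : ℕ) :
    MemLp (fun ω => ∑ t ∈ Finset.range T,
      (ψ (θ (t + 1 + 1) ω) - ∫ s, ψ (F (θ (t + 1) ω) s) ∂ζ)) 2 P ∧
    ∫ ω, (∑ t ∈ Finset.range T,
      (ψ (θ (t + 1 + 1) ω) - ∫ s, ψ (F (θ (t + 1) ω) s) ∂ζ)) ^ 2 ∂P ≤ T * (h * (C₃ * (2 * K))) := by
  set D : ℕ → Ω → ℝ := fun t ω => ψ (θ (t + 1 + 1) ω) - ∫ s, ψ (F (θ (t + 1) ω) s) ∂ζ with hD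
  have hD2 : ∀ t, MemLp (D t) 2 P := fun t => hM.memLp_increment hwm hψm hψ hmom (t + 1)
  have hS2 : ∀ T, MemLp (fun ω => ∑ t ∈ Finset.range T, D t ω) 2 P := fun T =>
    memLp_finsetSum _ fun t _ => hD2 t
  refine ⟨hS2 T, ?_⟩
  induction T with
  | zero => simp
  | succ n ih =>
    have hSm : Measurable[𝓕 (n + 1)] (fun ω => ∑ t ∈ Finset.range n, D t ω) := by
      refine Finset.measurable_fun_sum _ fun t ht => ?_
      refine (hM.measurable_increment hψm (t + 1)).mono (𝓕.mono ?_) le_rfl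
      have := Finset.mem_range.1 ht
      omega
    have hcross := hM.integral_mul_increment_eq_zero hwm hψm hψ hmom (n + 1) hSm (hS2 n)
    have hsq := hM.integral_increment_sq_le hwm hψm hψ hmom hdisp hh hC₃ (n + 1)
    have e : ∀ ω, (∑ t ∈ Finset.range (n + 1), D t ω) ^ 2
        = (∑ t ∈ Finset.range n, D t ω) ^ 2
          + (2 * ((∑ t ∈ Finset.range n, D t ω) * D n ω) + D n ω ^ 2) := fun ω => by
      rw [Finset.sum_range_succ]; ring
    have hi1 : Integrable (fun ω => (∑ t ∈ Finset.range n, D t ω) * D n ω) P :=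
      (hS2 n).integrable_mul (hD2 n)
    have hi2 : Integrable (fun ω => 2 * ((∑ t ∈ Finset.range n, D t ω) * D n ω) + D n ω ^ 2) P :=
      (hi1.const_mul 2).add (hD2 n).integrable_sq
    rw [integral_congr_ae (Filter.Eventually.of_forall e), integral_add (hS2 n).integrable_sq hi2,
      integral_add (hi1.const_mul 2) (hD2 n).integrable_sq, integral_const_mul]
    push_cast
    change ∫ ω, (∑ t ∈ Finset.range n, D t ω) * D n ω ∂P = 0 at hcross
    change ∫ ω, D n ω ^ 2 ∂P ≤ _ at hsq
    rw [hcross]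
    linarith

theorem integral_sum_sq_le_of_poisson (hM : IsNoiseDriven P ζ F 𝓕 θ z) (hwm : Measurable w)
    (hψm : Measurable ψ) (hLm : Measurable L) (hψ : ∀ x, |ψ x| ≤ C₁ * w x)
    (hmom : ∀ t, Integrable (fun ω => w (θ t ω) ^ 2) P ∧ ∫ ω, w (θ t ω) ^ 2 ∂P ≤ K)
    (hbias : ∀ x, Integrable (fun s => w (F x s) ^ 2) ζ →
      (∫ s, ψ (F x s) ∂ζ - ψ x - h * L x) ^ 2
        ≤ h ^ 4 * (C₂ * (w x ^ 2 + ∫ s, w (F x s) ^ 2 ∂ζ)))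
    (hdisp : ∀ x, Integrable (fun s => w (F x s) ^ 2) ζ →
      ∫ s, (ψ (F x s) - ψ x) ^ 2 ∂ζ ≤ h * (C₃ * (w x ^ 2 + ∫ s, w (F x s) ^ 2 ∂ζ)))
    (hh : 0 ≤ h) (hC₂ : 0 ≤ C₂) (hC₃ : 0 ≤ C₃) (T : ℕ) :
    ∫ ω, (h * ∑ t ∈ Finset.range T, L (θ (t + 1) ω)) ^ 2 ∂P
      ≤ 8 * K * (C₁ ^ 2 + T * h * C₃ + T ^ 2 * h ^ 4 * C₂) := by
  have hψ2 : ∀ t, MemLp (fun ω => ψ (θ t ω)) 2 P := fun t =>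
    memLp_of_abs_le hψm (hM.measurable_chain t) hwm hψ (hmom t).1
  have hψ3 : ∀ t, ∫ ω, ψ (θ t ω) ^ 2 ∂P ≤ C₁ ^ 2 * K := fun t => by
    calc _ ≤ ∫ ω, C₁ ^ 2 * w (θ t ω) ^ 2 ∂P := by
          refine integral_mono (hψ2 t).integrable_sq ((hmom t).1.const_mul _) fun ω => ?_
          have := pow_le_pow_left₀ (abs_nonneg _) (hψ (θ t ω)) 2
          rwa [sq_abs, mul_pow] at this
      _ ≤ _ := by rw [integral_const_mul]; gcongr; exact (hmom t).2
  set R : ℕ → Ω → ℝ := fun t ω =>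
    ∫ s, ψ (F (θ (t + 1) ω) s) ∂ζ - ψ (θ (t + 1) ω) - h * L (θ (t + 1) ω) with hR
  set D : ℕ → Ω → ℝ := fun t ω => ψ (θ (t + 1 + 1) ω) - ∫ s, ψ (F (θ (t + 1) ω) s) ∂ζ with hD
  have hRm : ∀ t, Measurable (R t) := fun t =>
    (((hM.measurable_integral_update hψm).comp (hM.measurable_chain _)).sub
      (hψm.comp (hM.measurable_chain _))).sub
      ((hLm.comp (hM.measurable_chain _)).const_mul h)
  have hRle : ∀ t, ∀ᵐ ω ∂P, R t ω ^ 2 ≤ h ^ 4 * (C₂ * (w (θ (t + 1) ω) ^ 2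
      + ∫ s, w (F (θ (t + 1) ω) s) ^ 2 ∂ζ)) := fun t => by
    filter_upwards [(hM.integral_weight_update hwm hmom (t + 1)).1] with ω hω using hbias _ hω
  have hRint : ∀ t, Integrable (fun ω => R t ω ^ 2) P := fun t => by
    refine (((hM.integral_weight_update hwm hmom (t + 1)).2.1.const_mul C₂).const_mul
      (h ^ 4)).mono' ((hRm t).pow_const 2).aestronglyMeasurable ?_
    filter_upwards [hRle t] with ω hω
    rwa [Real.norm_of_nonneg (sq_nonneg _)]
  have hRsq : ∀ t, ∫ ω, R t ω ^ 2 ∂P ≤ h ^ 4 * (C₂ * (2 * K)) := fun t => by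
    obtain ⟨-, k2, k3⟩ := hM.integral_weight_update hwm hmom (t + 1)
    refine (integral_mono_ae (hRint t) ((k2.const_mul C₂).const_mul (h ^ 4)) (hRle t)).trans ?_
    rw [integral_const_mul, integral_const_mul]
    gcongr
  obtain ⟨hSR, hSRle⟩ := integral_sum_sq_le
    (fun t => (memLp_two_iff_integrable_sq (hRm t).aestronglyMeasurable).2 (hRint t)) hRsq T
  obtain ⟨hSD, hSDle⟩ := hM.integral_sum_increment_sq_le hwm hψm hψ hmom hdisp hh hC₃ T
  -- The average runs over `θ 1, …, θ T`, so the telescoping sum of `ψ` goes from time `1` to time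
  -- `T + 1`.
  have e : ∀ ω, h * ∑ t ∈ Finset.range T, L (θ (t + 1) ω)
      = ψ (θ (T + 1) ω) - ψ (θ 1 ω) - ∑ t ∈ Finset.range T, D t ω
        - ∑ t ∈ Finset.range T, R t ω := fun ω => by
    have h1 := Finset.sum_range_sub (fun t => ψ (θ (t + 1) ω)) T
    rw [zero_add] at h1
    rw [← h1, ← Finset.sum_sub_distrib, ← Finset.sum_sub_distrib, Finset.mul_sum]
    refine Finset.sum_congr rfl fun t _ => ?_
    simp only [hR, hD]
    ring
  have hpt : ∀ ω, (h * ∑ t ∈ Finset.range T, L (θ (t + 1) ω)) ^ 2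
      ≤ 4 * (ψ (θ (T + 1) ω) ^ 2 + ψ (θ 1 ω) ^ 2 + (∑ t ∈ Finset.range T, D t ω) ^ 2
        + (∑ t ∈ Finset.range T, R t ω) ^ 2) := fun ω => by
    rw [e]
    generalize ψ (θ (T + 1) ω) = a
    generalize ψ (θ 1 ω) = b
    generalize ∑ t ∈ Finset.range T, D t ω = c
    generalize ∑ t ∈ Finset.range T, R t ω = d
    nlinarith only [sq_nonneg (a + b), sq_nonneg (a + c), sq_nonneg (a + d), sq_nonneg (b - c),
      sq_nonneg (b - d), sq_nonneg (c - d)]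
  have i1 := (hψ2 (T + 1)).integrable_sq
  have i2 := (hψ2 1).integrable_sq
  have i3 := hSD.integrable_sq
  have i4 := hSR.integrable_sq
  have hfin := integral_mono_of_nonneg (μ := P) (Filter.Eventually.of_forall fun ω => sq_nonneg _)
    ((((i1.add i2).add i3).add i4).const_mul 4) (Filter.Eventually.of_forall hpt)
  refine hfin.trans ?_
  rw [integral_const_mul]
  have e2 := integral_add ((i1.add i2).add i3) i4
  have e3 := integral_add (i1.add i2) i3
  have e4 := integral_add i1 i2
  simp only [Pi.add_apply] at e2 e3 e4 ⊢
  rw [e2, e3, e4]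
  have k1 := hψ3 (T + 1)
  have k2 := hψ3 1
  change ∫ ω, (∑ t ∈ Finset.range T, D t ω) ^ 2 ∂P ≤ _ at hSDle
  nlinarith only [k1, k2, hSDle, hSRle]

/-- Mean square error of the ergodic averages of `L`, where `h * L` is, up to an error of order
`h ^ 2`, the expected increment of `ψ`. -/
theorem integral_average_sq_le (hM : IsNoiseDriven P ζ F 𝓕 θ z) (hwm : Measurable w)
    (hψm : Measurable ψ) (hLm : Measurable L) (hψ : ∀ x, |ψ x| ≤ C₁ * w x)
    (hL : ∀ x, |L x| ≤ C₁ * w x)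
    (hmom : ∀ t, Integrable (fun ω => w (θ t ω) ^ 2) P ∧ ∫ ω, w (θ t ω) ^ 2 ∂P ≤ K)
    (hbias : ∀ x, Integrable (fun s => w (F x s) ^ 2) ζ →
      (∫ s, ψ (F x s) ∂ζ - ψ x - h * L x) ^ 2
        ≤ h ^ 4 * (C₂ * (w x ^ 2 + ∫ s, w (F x s) ^ 2 ∂ζ)))
    (hdisp : h ≤ 1 → ∀ x, Integrable (fun s => w (F x s) ^ 2) ζ →
      ∫ s, (ψ (F x s) - ψ x) ^ 2 ∂ζ ≤ h * (C₃ * (w x ^ 2 + ∫ s, w (F x s) ^ 2 ∂ζ)))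
    (hh : 0 < h) (hC₂ : 0 ≤ C₂) (hC₃ : 0 ≤ C₃) {T : ℕ} (hT : 0 < T) :
    Integrable (fun ω => ((T : ℝ)⁻¹ * ∑ t ∈ Finset.range T, L (θ (t + 1) ω)) ^ 2) P ∧
    ∫ ω, ((T : ℝ)⁻¹ * ∑ t ∈ Finset.range T, L (θ (t + 1) ω)) ^ 2 ∂P
      ≤ 8 * K * (C₁ ^ 2 + C₂ + C₃) * (1 / (h * T) + h ^ 2) := by
  have hK : 0 ≤ K := (integral_nonneg fun ω => sq_nonneg _).trans (hmom 0).2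
  have hL2 : ∀ t, MemLp (fun ω => L (θ (t + 1) ω)) 2 P := fun t =>
    memLp_of_abs_le hLm (hM.measurable_chain _) hwm hL (hmom _).1
  have hL3 : ∀ t, ∫ ω, L (θ (t + 1) ω) ^ 2 ∂P ≤ C₁ ^ 2 * K := fun t => by
    calc _ ≤ ∫ ω, C₁ ^ 2 * w (θ (t + 1) ω) ^ 2 ∂P := by
          refine integral_mono (hL2 t).integrable_sq ((hmom _).1.const_mul _) fun ω => ?_
          have := pow_le_pow_left₀ (abs_nonneg _) (hL (θ (t + 1) ω)) 2
          rwa [sq_abs, mul_pow] at this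
      _ ≤ _ := by rw [integral_const_mul]; gcongr; exact (hmom _).2
  obtain ⟨hS, hSle⟩ := integral_sum_sq_le hL2 hL3 T
  refine ⟨(hS.const_mul _).integrable_sq, ?_⟩
  have hT' : (0 : ℝ) < T := Nat.cast_pos.2 hT
  have hhT : 0 < h * T := mul_pos hh hT'
  have hq : 0 < 1 / (h * T) := by positivity
  have htriv : ∫ ω, ((T : ℝ)⁻¹ * ∑ t ∈ Finset.range T, L (θ (t + 1) ω)) ^ 2 ∂P ≤ C₁ ^ 2 * K := by
    simp_rw [mul_pow]
    rw [integral_const_mul]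
    calc _ ≤ (T : ℝ)⁻¹ ^ 2 * (T ^ 2 * (C₁ ^ 2 * K)) := by gcongr
      _ = C₁ ^ 2 * K := by field_simp
  have hconst : C₁ ^ 2 * K ≤ 8 * K * (C₁ ^ 2 + C₂ + C₃) := by
    nlinarith only [mul_nonneg hK hC₂, mul_nonneg hK hC₃, mul_nonneg hK (sq_nonneg C₁)]
  have hconst0 : 0 ≤ 8 * K * (C₁ ^ 2 + C₂ + C₃) := by positivity
  -- If the target rate is at least `1`, the moment bound `htriv` suffices. Otherwise `h ≤ 1`, as
  -- `hdisp` requires, and `(1 / (h T))² ≤ 1 / (h T)`.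
  by_cases hcase : 1 ≤ 1 / (h * T) + h ^ 2
  · exact (htriv.trans hconst).trans (le_mul_of_one_le_right hconst0 hcase)
  · push Not at hcase
    have hh1 : h ≤ 1 := by nlinarith only [hcase, hq, hh]
    have hq1 : 1 / (h * T) ≤ 1 := by nlinarith only [hcase, hq, hh]
    have hmain := hM.integral_sum_sq_le_of_poisson hwm hψm hLm hψ hmom hbias (hdisp hh1) hh.le
      hC₂ hC₃ T
    have e : ∀ ω, ((T : ℝ)⁻¹ * ∑ t ∈ Finset.range T, L (θ (t + 1) ω)) ^ 2
        = (1 / (h * T)) ^ 2 * (h * ∑ t ∈ Finset.range T, L (θ (t + 1) ω)) ^ 2 := fun ω => by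
      field_simp
    rw [integral_congr_ae (Filter.Eventually.of_forall e), integral_const_mul]
    calc _ ≤ (1 / (h * T)) ^ 2 * (8 * K * (C₁ ^ 2 + T * h * C₃ + T ^ 2 * h ^ 4 * C₂)) := by gcongr
      _ = 8 * K * (C₁ ^ 2 * (1 / (h * T)) ^ 2 + C₃ * (1 / (h * T)) + C₂ * h ^ 2) := by
          field_simp
      _ ≤ 8 * K * ((C₁ ^ 2 + C₂ + C₃) * (1 / (h * T) + h ^ 2)) := by
          gcongr
          generalize 1 / (h * (T : ℝ)) = q at hq hq1
          have h1 : C₁ ^ 2 * q ^ 2 ≤ C₁ ^ 2 * q := by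
            gcongr
            nlinarith only [hq, hq1]
          have h2 := mul_nonneg (sq_nonneg C₁) (sq_nonneg h)
          have h3 := mul_nonneg hC₂ hq.le
          have h4 := mul_nonneg hC₃ (sq_nonneg h)
          linarith
      _ = _ := by ring

end IsNoiseDriven

end MarkovChain

/-! ### One step with a random drift taking finitely many values. -/

section RandomDrift

variable {E : Type*} [NormedAddCommGroup E] [InnerProductSpace ℝ E] [FiniteDimensional ℝ E]
  [MeasurableSpace E] [BorelSpace E]
  {β : Type*} [MeasurableSpace β]

theorem measurable_gaussian_step [DiscreteMeasurableSpace β] (G : β → E) (x : E) (h : ℝ) :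
    Measurable (fun s : β × E => x + (h / 2) • G s.1 + √h • s.2) := by
  have : Measurable G := .of_discrete
  fun_prop

theorem IsWeight.ae_memLp_step {w : E → ℝ} {K : ℝ} (hw : IsWeight w K) {ν : Measure β}
    [IsProbabilityMeasure ν] {G : β → E} {x : E} {h : ℝ}
    (hint : Integrable (fun s : β × E => w (x + (h / 2) • G s.1 + √h • s.2) ^ 2)
      (ν.prod (stdGaussian E))) :
    ∀ᵐ b ∂ν, MemLp (fun ξ => w (x + (h / 2) • G b + √h • ξ)) 2 (stdGaussian E) := by
  filter_upwards [hint.prod_right_ae] with b hb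
  exact (memLp_two_iff_integrable_sq
    (hw.measurable.comp (by fun_prop)).aestronglyMeasurable).2 hb

variable [Fintype β] [DiscreteMeasurableSpace β]

/-- The bias of one step whose drift is random and independent of the Gaussian noise. -/
theorem IsWeight.sq_integral_random_step_sub_le {w : E → ℝ} {K c : ℝ} {ψ : E → ℝ}
    (hw : IsWeight w K) (hψ : IsDominated w c ψ) (ν : Measure β) [IsProbabilityMeasure ν]
    {G : β → E} {x : E} (hG : ∀ b, IsDriftDominated w c ψ x (G b)) {h : ℝ} (hh : 0 ≤ h)
    (hint : Integrable (fun s : β × E => w (x + (h / 2) • G s.1 + √h • s.2) ^ 2)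
      (ν.prod (stdGaussian E))) :
    (∫ s, ψ (x + (h / 2) • G s.1 + √h • s.2) ∂(ν.prod (stdGaussian E)) - ψ x
        - h * (1 / 2 * (fderiv ℝ ψ x (∫ b, G b ∂ν) + Laplacian.laplacian ψ x))) ^ 2
      ≤ h ^ 4 * (2 * ((Module.finrank ℝ E + 2) * c * (1 + K) * (1 + 2 * K)) ^ 2
        * (w x ^ 2 + ∫ s, w (x + (h / 2) • G s.1 + √h • s.2) ^ 2 ∂(ν.prod (stdGaussian E)))) := by
  set C := (Module.finrank ℝ E + 2) * c * (1 + K) * (1 + 2 * K)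
  have hstep := measurable_gaussian_step G x h
  have hw2 : MemLp (fun s : β × E => w (x + (h / 2) • G s.1 + √h • s.2)) 2
      (ν.prod (stdGaussian E)) :=
    (memLp_two_iff_integrable_sq (hw.measurable.comp hstep).aestronglyMeasurable).2 hint
  have hw1 := hw2.integrable (by norm_num)
  have hψ1 : Integrable (fun s : β × E => ψ (x + (h / 2) • G s.1 + √h • s.2))
      (ν.prod (stdGaussian E)) :=
    (hw1.const_mul c).mono' (hψ.contDiff.continuous.measurable.comp hstep).aestronglyMeasurable
      (Filter.Eventually.of_forall fun s => hψ.abs_le _)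
  have hGi : Integrable G ν := Integrable.of_finite
  have hDG : Integrable (fun b => fderiv ℝ ψ x (G b)) ν := Integrable.of_finite
  have hψ' : Integrable (fun b => ∫ ξ, ψ (x + (h / 2) • G b + √h • ξ) ∂(stdGaussian E)) ν :=
    hψ1.integral_prod_left
  have hsub : Integrable
      (fun b => ∫ ξ, ψ (x + (h / 2) • G b + √h • ξ) ∂(stdGaussian E) - ψ x) ν :=
    hψ'.sub (integrable_const _)
  have hlin : Integrable (fun b => h / 2 * (fderiv ℝ ψ x (G b) + Laplacian.laplacian ψ x)) ν :=
    Integrable.of_finite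
  -- The first-order term is linear in the drift, so averaging over `ν` only sees the mean drift;
  -- the remainder is bounded for each drift value separately.
  have e : ∫ s, ψ (x + (h / 2) • G s.1 + √h • s.2) ∂(ν.prod (stdGaussian E)) - ψ x
        - h * (1 / 2 * (fderiv ℝ ψ x (∫ b, G b ∂ν) + Laplacian.laplacian ψ x))
      = ∫ b, (∫ ξ, ψ (x + (h / 2) • G b + √h • ξ) ∂(stdGaussian E) - ψ x
        - h / 2 * (fderiv ℝ ψ x (G b) + Laplacian.laplacian ψ x)) ∂ν := by
    rw [integral_sub hsub hlin, integral_sub hψ' (integrable_const _), integral_prod _ hψ1,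
      integral_const_mul, integral_add hDG (integrable_const _),
      ContinuousLinearMap.integral_comp_comm _ hGi]
    simp
    ring
  have hle : |∫ s, ψ (x + (h / 2) • G s.1 + √h • s.2) ∂(ν.prod (stdGaussian E)) - ψ x
        - h * (1 / 2 * (fderiv ℝ ψ x (∫ b, G b ∂ν) + Laplacian.laplacian ψ x))|
      ≤ h ^ 2 * (C * (w x + ∫ s, w (x + (h / 2) • G s.1 + √h • s.2)
        ∂(ν.prod (stdGaussian E)))) := by
    have hd : Integrable (fun b => h ^ 2 * (C * (w x
        + ∫ ξ, w (x + (h / 2) • G b + √h • ξ) ∂(stdGaussian E)))) ν := Integrable.of_finite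
    rw [e, ← Real.norm_eq_abs]
    refine (norm_integral_le_of_norm_le hd ?_).trans (le_of_eq ?_)
    · filter_upwards [hw.ae_memLp_step hint] with b hb
      exact hw.abs_integral_step_sub_le hψ (hG b) hh hb
    · rw [integral_const_mul, integral_const_mul, integral_add (integrable_const _)
        hw1.integral_prod_left, integral_prod _ hw1]
      simp
  have hjensen : (∫ s, w (x + (h / 2) • G s.1 + √h • s.2) ∂(ν.prod (stdGaussian E))) ^ 2
      ≤ ∫ s, w (x + (h / 2) • G s.1 + √h • s.2) ^ 2 ∂(ν.prod (stdGaussian E)) := by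
    have hv := variance_nonneg (fun s : β × E => w (x + (h / 2) • G s.1 + √h • s.2))
      (ν.prod (stdGaussian E))
    rw [variance_eq_sub hw2] at hv
    simpa using hv
  have hsq := pow_le_pow_left₀ (abs_nonneg _) hle 2
  rw [sq_abs] at hsq
  refine hsq.trans ?_
  set A := ∫ s, w (x + (h / 2) • G s.1 + √h • s.2) ∂(ν.prod (stdGaussian E))
  have k : (w x + A) ^ 2 ≤ 2 * (w x ^ 2
      + ∫ s, w (x + (h / 2) • G s.1 + √h • s.2) ^ 2 ∂(ν.prod (stdGaussian E))) := by
    nlinarith only [sq_nonneg (w x - A), hjensen]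
  calc (h ^ 2 * (C * (w x + A))) ^ 2 = h ^ 4 * (C ^ 2 * (w x + A) ^ 2) := by ring
    _ ≤ h ^ 4 * (C ^ 2 * (2 * (w x ^ 2
      + ∫ s, w (x + (h / 2) • G s.1 + √h • s.2) ^ 2 ∂(ν.prod (stdGaussian E))))) := by gcongr
    _ = _ := by ring

/-- The mean square displacement of one step whose drift is random and independent of the
Gaussian noise. -/
theorem IsWeight.integral_random_step_sub_sq_le {w : E → ℝ} {K c : ℝ} {ψ : E → ℝ}
    (hw : IsWeight w K) (hψ : IsDominated w c ψ) :
    ∃ C : ℝ, 0 ≤ C ∧ ∀ (ν : Measure β) [IsProbabilityMeasure ν] (G : β → E) (x : E),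
    (∀ b, IsDriftDominated w c ψ x (G b)) → ∀ h : ℝ, 0 ≤ h → h ≤ 1 →
    Integrable (fun s : β × E => w (x + (h / 2) • G s.1 + √h • s.2) ^ 2)
      (ν.prod (stdGaussian E)) →
    ∫ s, (ψ (x + (h / 2) • G s.1 + √h • s.2) - ψ x) ^ 2 ∂(ν.prod (stdGaussian E))
      ≤ h * (C * (w x ^ 2
        + ∫ s, w (x + (h / 2) • G s.1 + √h • s.2) ^ 2 ∂(ν.prod (stdGaussian E)))) := by
  obtain ⟨C, hC, hb⟩ := hw.integral_step_sub_sq_le hψ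
  refine ⟨C, hC, fun ν _ G x hG h hh h1 hint => ?_⟩
  have hstep := measurable_gaussian_step G x h
  have hw2 : MemLp (fun s : β × E => w (x + (h / 2) • G s.1 + √h • s.2)) 2
      (ν.prod (stdGaussian E)) :=
    (memLp_two_iff_integrable_sq (hw.measurable.comp hstep).aestronglyMeasurable).2 hint
  have hψ2 : MemLp (fun s : β × E => ψ (x + (h / 2) • G s.1 + √h • s.2)) 2
      (ν.prod (stdGaussian E)) :=
    (hw2.const_mul c).mono' (hψ.contDiff.continuous.measurable.comp hstep).aestronglyMeasurable
      (Filter.Eventually.of_forall fun s => hψ.abs_le _)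
  have hd : MemLp (fun s : β × E => ψ (x + (h / 2) • G s.1 + √h • s.2) - ψ x) 2
      (ν.prod (stdGaussian E)) := hψ2.sub (memLp_const _)
  rw [integral_prod _ hd.integrable_sq, integral_prod _ hint]
  have h2 : ∫ b, h * (C * (w x ^ 2
      + ∫ ξ, w (x + (h / 2) • G b + √h • ξ) ^ 2 ∂(stdGaussian E))) ∂ν
      = h * (C * (w x ^ 2
      + ∫ b, ∫ ξ, w (x + (h / 2) • G b + √h • ξ) ^ 2 ∂(stdGaussian E) ∂ν)) := by
    rw [integral_const_mul, integral_const_mul, integral_add (integrable_const _)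
      hint.integral_prod_left]
    simp
  rw [← h2]
  refine integral_mono_ae Integrable.of_finite Integrable.of_finite ?_
  filter_upwards [hw.ae_memLp_step hint] with b hbm
  exact hb x (G b) (hG b) h hh h1 hbm

end RandomDrift

/-! ### Regrouping independent random variables. -/

section Independence

theorem ProbabilityTheory.IndepFun.prodMk_left_of_prodMk_right {Ω α β γ : Type*}
    [MeasurableSpace Ω] [MeasurableSpace α] [MeasurableSpace β] [MeasurableSpace γ]
    {P : Measure Ω} [IsProbabilityMeasure P] {X : Ω → α} {Y : Ω → β} {Z : Ω → γ}
    (hX : Measurable X) (hY : Measurable Y) (hZ : Measurable Z)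
    (h : IndepFun X (fun ω => (Y ω, Z ω)) P) (hYZ : IndepFun Y Z P) :
    IndepFun (fun ω => (X ω, Y ω)) Z P := by
  have hXY : IndepFun X Y P := h.comp measurable_id measurable_fst
  rw [indepFun_iff_map_prod_eq_prod_map_map (by fun_prop) (by fun_prop)] at h hYZ hXY ⊢
  have := Measure.isProbabilityMeasure_map (μ := P) hX.aemeasurable
  have := Measure.isProbabilityMeasure_map (μ := P) hY.aemeasurable
  have := Measure.isProbabilityMeasure_map (μ := P) hZ.aemeasurable
  rw [hYZ] at h
  rw [hXY]
  have e : P.map (fun ω => ((X ω, Y ω), Z ω))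
      = (P.map (fun ω => (X ω, (Y ω, Z ω)))).map MeasurableEquiv.prodAssoc.symm := by
    rw [Measure.map_map (by fun_prop) (by fun_prop)]
    rfl
  rw [e, h, ← Measure.prodAssoc_prod, Measure.map_map (by fun_prop) (by fun_prop)]
  simp

end Independence

/-! ### Power weights and growth of derivatives. -/

section Growth

theorem one_add_rpow_le {x κ : ℝ} (hx : 0 ≤ x) (hκ : 0 ≤ κ) :
    (1 + x) ^ κ ≤ 2 ^ κ * (1 + x ^ κ) := by
  have h1 : (1 + x) ^ κ ≤ (2 * max 1 x) ^ κ := by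
    refine Real.rpow_le_rpow (by positivity) ?_ hκ
    linarith [le_max_left 1 x, le_max_right 1 x]
  rw [Real.mul_rpow (by norm_num) (by positivity)] at h1
  refine h1.trans ?_
  gcongr
  have hxκ : 0 ≤ x ^ κ := Real.rpow_nonneg hx κ
  rcases max_choice 1 x with h | h <;> rw [h]
  · rw [Real.one_rpow]; linarith
  · linarith

/-- Both factors are dominated by powers of `max x y`. It separates products of a derivative of `ψ`
at one point and a drift at another. -/
theorem rpow_mul_rpow_le_add {x y a b κ : ℝ} (hx : 1 ≤ x) (hy : 1 ≤ y) (ha : 0 ≤ a) (hb : 0 ≤ b)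
    (hκ : a + b ≤ κ) : x ^ a * y ^ b ≤ x ^ κ + y ^ κ := by
  have h1 : 1 ≤ max x y := hx.trans (le_max_left _ _)
  calc x ^ a * y ^ b ≤ max x y ^ a * max x y ^ b := by
        gcongr
        · exact le_max_left _ _
        · exact le_max_right _ _
    _ = max x y ^ (a + b) := (Real.rpow_add (by linarith) _ _).symm
    _ ≤ max x y ^ κ := Real.rpow_le_rpow_of_exponent_le h1 hκ
    _ ≤ x ^ κ + y ^ κ := by
        have : 0 ≤ x ^ κ := by positivity
        have : 0 ≤ y ^ κ := by positivity
        rcases max_choice x y with h | h <;> rw [h] <;> linarith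

variable {E : Type*} [NormedAddCommGroup E] [InnerProductSpace ℝ E]

/-- The weight `(1 + Γ) ^ κ` of a function `Γ` whose powers are controlled along segments. -/
theorem isWeight_one_add_rpow [MeasurableSpace E] {Γ : E → ℝ} (hΓ : Measurable Γ)
    (hΓ0 : ∀ x, 0 ≤ Γ x) {κ c : ℝ} (hκ : 0 ≤ κ)
    (hseg : ∀ x y : E, ∀ u ∈ Set.Ioo (0 : ℝ) 1,
      Γ (u • x + (1 - u) • y) ^ κ ≤ c * (Γ x ^ κ + Γ y ^ κ)) :
    IsWeight (fun x => (1 + Γ x) ^ κ) (2 ^ κ * (1 + |c|)) where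
  measurable := (hΓ.const_add 1).pow_const κ
  one_le x := Real.one_le_rpow (by linarith [hΓ0 x]) hκ
  segment x y u hu := by
    have hx1 : 1 ≤ (1 + Γ x) ^ κ := Real.one_le_rpow (by linarith [hΓ0 x]) hκ
    have hy1 : 1 ≤ (1 + Γ y) ^ κ := Real.one_le_rpow (by linarith [hΓ0 y]) hκ
    have hK : 1 ≤ 2 ^ κ * (1 + |c|) := by
      have h1 : (1 : ℝ) ≤ 2 ^ κ := Real.one_le_rpow (by norm_num) hκ
      nlinarith [abs_nonneg c]
    -- The growth hypothesis covers only the open interval; at the endpoints the bound is trivial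
    -- because the constant is at least `1`.
    rcases eq_or_ne u 0 with rfl | h0
    · simp only [zero_smul, sub_zero, one_smul, zero_add]
      nlinarith
    rcases eq_or_ne u 1 with rfl | h1
    · simp only [sub_self, zero_smul, one_smul, add_zero]
      nlinarith
    have hu' : u ∈ Set.Ioo (0 : ℝ) 1 := ⟨lt_of_le_of_ne hu.1 h0.symm, lt_of_le_of_ne hu.2 h1⟩
    have hxle : Γ x ^ κ ≤ (1 + Γ x) ^ κ := Real.rpow_le_rpow (hΓ0 x) (by linarith) hκ
    have hyle : Γ y ^ κ ≤ (1 + Γ y) ^ κ := Real.rpow_le_rpow (hΓ0 y) (by linarith) hκ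
    have hx0 : 0 ≤ Γ x ^ κ := Real.rpow_nonneg (hΓ0 x) κ
    have hy0 : 0 ≤ Γ y ^ κ := Real.rpow_nonneg (hΓ0 y) κ
    refine (one_add_rpow_le (hΓ0 _) hκ).trans ?_
    rw [mul_assoc]
    gcongr
    calc 1 + Γ (u • x + (1 - u) • y) ^ κ ≤ 1 + |c| * (Γ x ^ κ + Γ y ^ κ) := by
          gcongr
          exact (hseg x y u hu').trans (by gcongr; exact le_abs_self c)
      _ ≤ ((1 + Γ x) ^ κ + (1 + Γ y) ^ κ) + |c| * ((1 + Γ x) ^ κ + (1 + Γ y) ^ κ) := by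
          gcongr
          linarith
      _ = _ := by ring

theorem norm_iteratedFDeriv_fderiv_apply_le {f : E → ℝ} (hf : ContDiff ℝ 3 f) (v x : E) {j : ℕ}
    (hj : j ≤ 2) :
    ‖iteratedFDeriv ℝ j (fun y => fderiv ℝ f y v) x‖ ≤ ‖v‖ * ‖iteratedFDeriv ℝ (j + 1) f x‖ := by
  rw [← norm_iteratedFDeriv_fderiv]
  exact norm_iteratedFDeriv_clm_apply_const
    (hf.fderiv_right (m := 2) (by norm_num)).contDiffAt (by exact_mod_cast hj)

variable [FiniteDimensional ℝ E]

theorem inner_gradient_gradient_eq_sum (f g : E → ℝ) (x : E) :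
    inner ℝ (∇ f x) (∇ g x) = ∑ i, fderiv ℝ f x (stdOrthonormalBasis ℝ E i)
      * fderiv ℝ g x (stdOrthonormalBasis ℝ E i) := by
  rw [← (stdOrthonormalBasis ℝ E).sum_inner_mul_inner]
  refine Finset.sum_congr rfl fun i _ => ?_
  rw [inner_gradient_left, inner_gradient_right]
  simp

theorem contDiff_inner_gradient {f g : E → ℝ} (hf : ContDiff ℝ 3 f) (hg : ContDiff ℝ 3 g) :
    ContDiff ℝ 2 (fun x => inner ℝ (∇ f x) (∇ g x)) := by
  simp_rw [inner_gradient_gradient_eq_sum]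
  refine ContDiff.sum fun i _ => ?_
  exact ((hf.fderiv_right (m := 2) (by norm_num)).clm_apply contDiff_const).mul
    ((hg.fderiv_right (m := 2) (by norm_num)).clm_apply contDiff_const)

/-- The Leibniz rule in each orthonormal coordinate; `4 = 1 + 2 + 1` is the sum of the binomial
coefficients. -/
theorem norm_iteratedFDeriv_two_inner_gradient_le {f g : E → ℝ} (hf : ContDiff ℝ 3 f)
    (hg : ContDiff ℝ 3 g) {x : E} {a b : ℝ}
    (ha : ∀ j ∈ Finset.Icc 1 3, ‖iteratedFDeriv ℝ j f x‖ ≤ a)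
    (hb : ∀ j ∈ Finset.Icc 1 3, ‖iteratedFDeriv ℝ j g x‖ ≤ b) :
    ‖iteratedFDeriv ℝ 2 (fun x => inner ℝ (∇ f x) (∇ g x)) x‖
      ≤ Module.finrank ℝ E * (4 * (a * b)) := by
  have hcf : ∀ i, ContDiff ℝ 2 (fun x => fderiv ℝ f x (stdOrthonormalBasis ℝ E i)) := fun i =>
    (hf.fderiv_right (m := 2) (by norm_num)).clm_apply contDiff_const
  have hcg : ∀ i, ContDiff ℝ 2 (fun x => fderiv ℝ g x (stdOrthonormalBasis ℝ E i)) := fun i =>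
    (hg.fderiv_right (m := 2) (by norm_num)).clm_apply contDiff_const
  simp_rw [inner_gradient_gradient_eq_sum]
  rw [iteratedFDeriv_fun_sum_apply fun i _ => ((hcf i).mul (hcg i)).contDiffAt]
  refine (norm_sum_le _ _).trans ?_
  refine (Finset.sum_le_card_nsmul _ _ (4 * (a * b)) fun i _ => ?_).trans (by simp)
  refine (norm_iteratedFDeriv_mul_le (hcf i) (hcg i) x le_rfl).trans ?_
  have hfj : ∀ j ≤ 2, ‖iteratedFDeriv ℝ j (fun x => fderiv ℝ f x (stdOrthonormalBasis ℝ E i)) x‖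
      ≤ a := fun j hj => by
    refine (norm_iteratedFDeriv_fderiv_apply_le hf _ x hj).trans ?_
    simpa using ha (j + 1) (by simp; omega)
  have hgj : ∀ j ≤ 2, ‖iteratedFDeriv ℝ j (fun x => fderiv ℝ g x (stdOrthonormalBasis ℝ E i)) x‖
      ≤ b := fun j hj => by
    refine (norm_iteratedFDeriv_fderiv_apply_le hg _ x hj).trans ?_
    simpa using hb (j + 1) (by simp; omega)
  have ha0 : 0 ≤ a := (norm_nonneg _).trans (hfj 0 (by norm_num))
  have key : ∀ j ≤ 2, ‖iteratedFDeriv ℝ j (fun x => fderiv ℝ f x (stdOrthonormalBasis ℝ E i)) x‖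
      * ‖iteratedFDeriv ℝ (2 - j) (fun x => fderiv ℝ g x (stdOrthonormalBasis ℝ E i)) x‖
      ≤ a * b := fun j hj =>
    mul_le_mul (hfj j hj) (hgj _ (Nat.sub_le _ _)) (norm_nonneg _) ha0
  have k0 := key 0 (by norm_num)
  have k1 := key 1 (by norm_num)
  have k2 := key 2 (by norm_num)
  simp only [Finset.sum_range_succ, Finset.sum_range_zero, Nat.choose_zero_right,
    Nat.choose_one_right,
    Nat.choose_self, Nat.cast_one, one_mul, zero_add, Nat.cast_ofNat]
  nlinarith only [k0, k1, k2]

theorem norm_fderiv_laplacian_le {ψ : E → ℝ} (hψ : ContDiff ℝ 3 ψ) (x : E) :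
    ‖fderiv ℝ (Laplacian.laplacian ψ) x‖
      ≤ Module.finrank ℝ E * ‖iteratedFDeriv ℝ 3 ψ x‖ := by
  have hd : DifferentiableAt ℝ (iteratedFDeriv ℝ 2 ψ) x :=
    (hψ.differentiable_iteratedFDeriv (m := 2) (by norm_num)) x
  rw [laplacian_eq_iteratedFDeriv_stdOrthonormalBasis]
  set A : Fin (Module.finrank ℝ E) → (ContinuousMultilinearMap ℝ (fun _ : Fin 2 => E) ℝ →L[ℝ] ℝ) :=
    fun i => ContinuousMultilinearMap.apply ℝ (fun _ : Fin 2 => E) ℝ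
      ![stdOrthonormalBasis ℝ E i, stdOrthonormalBasis ℝ E i] with hA
  have hAn : ∀ i, ‖A i‖ ≤ 1 := fun i => by
    refine ContinuousLinearMap.opNorm_le_bound _ zero_le_one fun f => ?_
    have := f.le_opNorm ![stdOrthonormalBasis ℝ E i, stdOrthonormalBasis ℝ E i]
    simpa [hA, Fin.prod_univ_two] using this
  have hder : HasFDerivAt (fun y => ∑ i, iteratedFDeriv ℝ 2 ψ y
      ![stdOrthonormalBasis ℝ E i, stdOrthonormalBasis ℝ E i])
      (∑ i, (A i).comp (fderiv ℝ (iteratedFDeriv ℝ 2 ψ) x)) x :=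
    HasFDerivAt.fun_sum fun i _ => (A i).hasFDerivAt.comp x hd.hasFDerivAt
  rw [hder.fderiv]
  refine (norm_sum_le _ _).trans ?_
  refine (Finset.sum_le_card_nsmul _ _ ‖iteratedFDeriv ℝ 3 ψ x‖ fun i _ => ?_).trans (by simp)
  refine (ContinuousLinearMap.opNorm_comp_le _ _).trans ?_
  rw [norm_fderiv_iteratedFDeriv]
  exact mul_le_of_le_one_left (norm_nonneg _) (hAn i)

end Growth

/-! ### Gradients of the log-posterior and of the surrogates. -/

namespace FederatedModel

variable {X : Type*} {d S : ℕ} (M : FederatedModel X d S)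

section Gradient

theorem gradient_eq_toDual_symm {f : Param d → ℝ} {θ : Param d} :
    ∇ f θ = (toDual ℝ (Param d)).symm (fderiv ℝ f θ) := rfl

theorem norm_gradient (f : Param d → ℝ) (θ : Param d) : ‖∇ f θ‖ = ‖fderiv ℝ f θ‖ := by
  rw [gradient_eq_toDual_symm, LinearIsometryEquiv.norm_map]

theorem measurable_gradient (f : Param d → ℝ) : Measurable (∇ f) :=
  (LinearIsometryEquiv.continuous _).measurable.comp (measurable_fderiv ℝ f)

theorem gradient_logPost (θ : Param d) :
    ∇ M.logPost θ = ∇ (fun η => Real.log (M.prior η)) θ + ∑ s, ∑ i, M.gradLik s i θ := by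
  have hp : DifferentiableAt ℝ (fun η => Real.log (M.prior η)) θ :=
    (M.prior_diff θ).log (M.prior_pos θ).ne'
  have hl : ∀ s i, DifferentiableAt ℝ (fun η => Real.log (M.lik (M.x s i) η)) θ := fun s i =>
    (M.lik_diff s i θ).log (M.lik_pos s i θ).ne'
  have e : M.logPost = fun η => Real.log (M.prior η)
      + ∑ s, ∑ i, Real.log (M.lik (M.x s i) η) := by
    ext η
    rw [logPost, post, Real.log_mul (M.prior_pos η).ne'
      (Finset.prod_ne_zero_iff.2 fun s _ => Finset.prod_ne_zero_iff.2 fun i _ =>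
        (M.lik_pos s i η).ne'), Real.log_prod fun s _ => Finset.prod_ne_zero_iff.2 fun i _ =>
        (M.lik_pos s i η).ne']
    congr 1
    exact Finset.sum_congr rfl fun s _ => Real.log_prod fun i _ => (M.lik_pos s i η).ne'
  have h : HasFDerivAt M.logPost (fderiv ℝ (fun η => Real.log (M.prior η)) θ
      + ∑ s, ∑ i, fderiv ℝ (fun η => Real.log (M.lik (M.x s i) η)) θ) θ := by
    rw [e]
    exact hp.hasFDerivAt.add (HasFDerivAt.fun_sum fun s _ => HasFDerivAt.fun_sum fun i _ =>
      (hl s i).hasFDerivAt)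
  simp only [gradLik, gradient_eq_toDual_symm]
  rw [h.fderiv]
  simp only [map_add, map_sum]

theorem gradient_log_prod_surrogate (θ : Param d) :
    ∇ (fun η => Real.log (∏ s, M.q s η)) θ = ∑ s, M.gradSurr s θ := by
  have e : (fun η => Real.log (∏ s, M.q s η)) = fun η => ∑ s, Real.log (M.q s η) := by
    ext η
    exact Real.log_prod fun s _ => (M.q_pos s η).ne'
  have h : HasFDerivAt (fun η => ∑ s, Real.log (M.q s η))
      (∑ s, fderiv ℝ (fun η => Real.log (M.q s η)) θ) θ :=
    HasFDerivAt.fun_sum fun s _ => ((M.q_diff s θ).log (M.q_pos s θ).ne').hasFDerivAt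
  simp only [gradSurr, gradient_eq_toDual_symm]
  rw [e, h.fderiv, map_sum]

end Gradient

/-! ### Mini-batches: unbiasedness and size of the stochastic drift. -/

section Batch

variable {m : ℕ}

instance : DiscreteMeasurableSpace (M.Batch m) where
  forall_measurableSet s := by
    refine MeasurableSpace.measurableSet_iInf.2 fun a => ?_
    exact (MeasurableSet.of_discrete : MeasurableSet (Sigma.mk a ⁻¹' s))

theorem batchPMF_apply (s : Fin S) (i : Fin m → Fin (M.N s)) :
    M.batchPMF m ⟨s, i⟩ = M.f s * ((M.N s : ENNReal) ^ m)⁻¹ := by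
  rw [batchPMF, PMF.bind_apply, tsum_eq_single s]
  · rw [PMF.map_apply, tsum_eq_single i]
    · simp [PMF.uniformOfFintype_apply]
    · intro j hj
      simp [hj.symm]
  · intro s' hs'
    rw [PMF.map_apply]
    have h : ∀ j : Fin m → Fin (M.N s'), (⟨s, i⟩ : M.Batch m) ≠ ⟨s', j⟩ := fun j hj =>
      hs' (congrArg Sigma.fst hj).symm
    simp [h]

theorem prob_pos (s : Fin S) : 0 < M.prob s :=
  ENNReal.toReal_pos (M.f_ne_zero s) (M.f.apply_ne_top s)

theorem sum_prob : ∑ s, M.prob s = 1 := by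
  have h := M.f.tsum_coe
  rw [tsum_fintype] at h
  simp only [prob]
  rw [← ENNReal.toReal_sum fun s _ => M.f.apply_ne_top s, h, ENNReal.toReal_one]

theorem integral_batchPMF (V : M.Batch m → Param d) :
    ∫ b, V b ∂(M.batchPMF m).toMeasure
      = ∑ s, M.prob s • (((M.N s : ℝ) ^ m)⁻¹ • ∑ i, V ⟨s, i⟩) := by
  rw [PMF.integral_eq_sum, Fintype.sum_sigma]
  refine Finset.sum_congr rfl fun s _ => ?_
  rw [Finset.smul_sum, Finset.smul_sum]
  refine Finset.sum_congr rfl fun i _ => ?_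
  rw [batchPMF_apply, ENNReal.toReal_mul, ENNReal.toReal_inv, ENNReal.toReal_pow,
    ENNReal.toReal_natCast, mul_smul, prob]

/-- The stochastic drift of the chain. -/
noncomputable def drift (b : M.Batch m) (θ : Param d) : Param d :=
  M.dsgldGrad b θ + M.conduciveGrad b.1 θ

/-- For each of the `m` slots, a given data point occupies that slot in `N_s ^ (m - 1)` of the index
tuples. -/
theorem sum_batch_gradLik (s : Fin S) (θ : Param d) :
    ∑ i : Fin m → Fin (M.N s), ∑ j, M.gradLik s (i j) θ
      = ((m : ℝ) * (M.N s : ℝ) ^ (m - 1)) • ∑ k, M.gradLik s k θ := by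
  rw [Finset.sum_comm]
  have h : ∀ j : Fin m, ∑ i : Fin m → Fin (M.N s), M.gradLik s (i j) θ
      = ((M.N s : ℝ) ^ (m - 1)) • ∑ k, M.gradLik s k θ := fun j => by
    have := Fintype.sum_piFinset_apply (fun k => M.gradLik s k θ) Finset.univ j
    rw [Fintype.piFinset_univ] at this
    rw [this]
    simp [← Nat.cast_smul_eq_nsmul ℝ]
  simp_rw [h]
  rw [Finset.sum_const, Finset.card_univ, Fintype.card_fin, ← Nat.cast_smul_eq_nsmul ℝ, smul_smul]

/-- The stochastic drift is an unbiased estimate of the gradient of the log-posterior. -/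
theorem integral_drift (hm : 0 < m) (θ : Param d) :
    ∫ b, M.drift b θ ∂(M.batchPMF m).toMeasure = ∇ M.logPost θ := by
  rw [integral_batchPMF, gradient_logPost]
  -- The selection probability cancels the factors `1 / f_s` on the likelihood and surrogate terms.
  -- Summed over `s`, the two surrogate contributions then cancel.
  have h : ∀ s, M.prob s • (((M.N s : ℝ) ^ m)⁻¹ • ∑ i, M.drift (⟨s, i⟩ : M.Batch m) θ)
      = M.prob s • (∇ (fun η => Real.log (M.prior η)) θ + ∑ s, M.gradSurr s θ)
        + (∑ i, M.gradLik s i θ - M.gradSurr s θ) := fun s => by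
    have hf := (M.prob_pos s).ne'
    have hN : (M.N s : ℝ) ≠ 0 := Nat.cast_ne_zero.2 (M.N_pos s).ne'
    have hm' : (m : ℝ) ≠ 0 := Nat.cast_ne_zero.2 hm.ne'
    have hpow : (M.N s : ℝ) ^ m = M.N s * (M.N s : ℝ) ^ (m - 1) := by
      rw [← pow_succ', Nat.sub_add_cancel hm]
    simp only [drift, dsgldGrad, conduciveGrad, gradient_log_prod_surrogate]
    rw [Finset.sum_add_distrib, Finset.sum_add_distrib, ← Finset.smul_sum, sum_batch_gradLik M,
      Finset.sum_const, Finset.sum_const, Finset.card_univ]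
    simp only [Fintype.card_fun, Fintype.card_fin, ← Nat.cast_smul_eq_nsmul ℝ, Nat.cast_pow]
    have hn : (M.N s : ℝ) ^ (m - 1) ≠ 0 := pow_ne_zero _ hN
    rw [hpow]
    generalize (M.N s : ℝ) ^ (m - 1) = n at hn
    match_scalars <;> field_simp
  simp_rw [h]
  rw [Finset.sum_add_distrib, ← Finset.sum_smul, sum_prob, one_smul, Finset.sum_sub_distrib]
  abel

theorem measurable_gradLik (s : Fin S) (i : Fin (M.N s)) : Measurable (M.gradLik s i) :=
  measurable_gradient _

theorem measurable_drift (b : M.Batch m) : Measurable (M.drift b) := by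
  have h1 := measurable_gradient (d := d) (fun η => Real.log (M.prior η))
  have h2 := measurable_gradient (d := d) (fun η => Real.log (∏ s', M.q s' η))
  have h3 : Measurable (M.gradSurr b.1) := measurable_gradient _
  have h4 : Measurable (fun θ => ∑ j, M.gradLik b.1 (b.2 j) θ) :=
    Finset.measurable_fun_sum _ fun j _ => M.measurable_gradLik _ _
  exact (h1.add (h4.const_smul ((M.N b.1 : ℝ) / (M.prob b.1 * m)))).add
    (h2.sub (h3.const_smul (M.prob b.1)⁻¹))

/-- Likelihood and surrogate gradients are bounded and there are finitely many batches, so the noise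
of the drift is uniformly bounded. The drift thus inherits the growth of `∇ log π`. -/
theorem norm_drift_le (hq : ∀ s, ∃ K : NNReal, LipschitzWith K (fun θ => Real.log (M.q s θ)))
    (γ : Fin S → ℝ) (hγ : ∀ s i θ, ‖M.gradLik s i θ‖ ≤ γ s) :
    ∃ C : ℝ, 0 ≤ C ∧ ∀ (b : M.Batch m) θ, ‖M.drift b θ‖ ≤ ‖∇ M.logPost θ‖ + C := by
  choose K hK using hq
  have hsurr : ∀ s θ, ‖M.gradSurr s θ‖ ≤ K s := fun s θ => by
    rw [gradSurr, norm_gradient]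
    exact norm_fderiv_le_of_lipschitz ℝ (hK s)
  let c : M.Batch m → ℝ := fun b => ∑ s, ∑ _i : Fin (M.N s), |γ s|
    + |(M.N b.1 : ℝ) / (M.prob b.1 * m)| * ∑ _j : Fin m, |γ b.1| + ∑ s, (K s : ℝ)
    + |(M.prob b.1)⁻¹| * K b.1
  have hc0 : ∀ b, 0 ≤ c b := fun b => by positivity
  have hγ' : ∀ s i θ, ‖M.gradLik s i θ‖ ≤ |γ s| := fun s i θ => (hγ s i θ).trans (le_abs_self _)
  refine ⟨∑ b, c b, Finset.sum_nonneg fun b _ => hc0 b, fun b θ => ?_⟩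
  have hcb : c b ≤ ∑ b, c b := Finset.single_le_sum (fun b _ => hc0 b) (Finset.mem_univ b)
  -- The prior gradient, which carries no bound of its own, is expressed through the posterior
  -- gradient.
  have e : M.drift b θ = ∇ M.logPost θ - ∑ s, ∑ i, M.gradLik s i θ
      + ((M.N b.1 : ℝ) / (M.prob b.1 * m)) • ∑ j, M.gradLik b.1 (b.2 j) θ
      + ∑ s, M.gradSurr s θ - (M.prob b.1)⁻¹ • M.gradSurr b.1 θ := by
    simp only [drift, dsgldGrad, conduciveGrad, gradient_log_prod_surrogate, gradient_logPost]
    abel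
  have h1 : ‖∑ s, ∑ i, M.gradLik s i θ‖ ≤ ∑ s, ∑ _i : Fin (M.N s), |γ s| :=
    norm_sum_le_of_le _ fun s _ => norm_sum_le_of_le _ fun i _ => hγ' s i θ
  have h2 : ‖((M.N b.1 : ℝ) / (M.prob b.1 * m)) • ∑ j, M.gradLik b.1 (b.2 j) θ‖
      ≤ |(M.N b.1 : ℝ) / (M.prob b.1 * m)| * ∑ _j : Fin m, |γ b.1| := by
    rw [norm_smul, Real.norm_eq_abs]
    gcongr
    exact norm_sum_le_of_le _ fun j _ => hγ' _ _ θ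
  have h3 : ‖∑ s, M.gradSurr s θ‖ ≤ ∑ s, (K s : ℝ) := norm_sum_le_of_le _ fun s _ => hsurr s θ
  have h4 : ‖(M.prob b.1)⁻¹ • M.gradSurr b.1 θ‖ ≤ |(M.prob b.1)⁻¹| * K b.1 := by
    rw [norm_smul, Real.norm_eq_abs]
    gcongr
    exact hsurr _ θ
  rw [e]
  refine (norm_sub_le _ _).trans ?_
  have k1 := norm_add_le (∇ M.logPost θ - ∑ s, ∑ i, M.gradLik s i θ
      + ((M.N b.1 : ℝ) / (M.prob b.1 * m)) • ∑ j, M.gradLik b.1 (b.2 j) θ) (∑ s, M.gradSurr s θ)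
  have k2 := norm_add_le (∇ M.logPost θ - ∑ s, ∑ i, M.gradLik s i θ)
    (((M.N b.1 : ℝ) / (M.prob b.1 * m)) • ∑ j, M.gradLik b.1 (b.2 j) θ)
  have k3 := norm_sub_le (∇ M.logPost θ) (∑ s, ∑ i, M.gradLik s i θ)
  have hcdef : c b = ∑ s, ∑ _i : Fin (M.N s), |γ s|
    + |(M.N b.1 : ℝ) / (M.prob b.1 * m)| * ∑ _j : Fin m, |γ b.1| + ∑ s, (K s : ℝ)
    + |(M.prob b.1)⁻¹| * K b.1 := rfl
  linarith

end Batch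

/-! ### The chain as a noise-driven Markov chain. -/

section Chain

variable {m : ℕ} {Ω : Type*} [MeasurableSpace Ω]

/-- One update of the chain. -/
noncomputable def update (h : ℝ) (θ : Param d) (s : M.Batch m × Param d) : Param d :=
  θ + (h / 2) • M.drift s.1 θ + √h • s.2

theorem measurable_drift_uncurry :
    Measurable (fun q : Param d × M.Batch m => M.drift q.2 q.1) :=
  measurable_from_prod_countable_left fun b => M.measurable_drift b

theorem measurable_update (h : ℝ) : Measurable (Function.uncurry (M.update (m := m) h)) := by
  have hp : Measurable (fun q : Param d × (M.Batch m × Param d) => (q.1, q.2.1)) := by fun_prop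
  have h1 := (M.measurable_drift_uncurry (m := m)).comp hp
  have h2 : Measurable (fun q : Param d × (M.Batch m × Param d) => M.drift q.2.1 q.1) := h1
  have h3 : Measurable (fun q : Param d × (M.Batch m × Param d) => q.2.2) := measurable_snd.snd
  unfold Function.uncurry update
  exact (measurable_fst.add (h2.const_smul (h / 2))).add (h3.const_smul (√h))

/-- The initial state together with the noise before time `t`. -/
def pastNoise (θ₀ : Ω → Param d) (B : ℕ → Ω → M.Batch m) (ξ : ℕ → Ω → Param d) (t : ℕ) (ω : Ω) :
    Param d × (Finset.range t → M.Batch m × Param d) :=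
  (θ₀ ω, fun i => (B i ω, ξ i ω))

variable {P : Measure Ω} {θ₀ : Ω → Param d} {B : ℕ → Ω → M.Batch m} {ξ : ℕ → Ω → Param d}

theorem IsDriving.measurable_pair {M : FederatedModel X d S} {B : ℕ → Ω → M.Batch m}
    (hdrive : M.IsDriving P θ₀ B ξ) (t : ℕ) : Measurable (fun ω => (B t ω, ξ t ω)) :=
  (hdrive.measurable_batch t).prodMk (hdrive.measurable_noise t)

theorem IsDriving.measurable_pastNoise {M : FederatedModel X d S} {B : ℕ → Ω → M.Batch m}
    (hdrive : M.IsDriving P θ₀ B ξ) (t : ℕ) : Measurable (M.pastNoise θ₀ B ξ t) :=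
  hdrive.measurable_init.prodMk (measurable_pi_lambda _ fun i => hdrive.measurable_pair i)

/-- The filtration generated by the initial state and the noise. -/
def IsDriving.filtration {M : FederatedModel X d S} {B : ℕ → Ω → M.Batch m}
    (hdrive : M.IsDriving P θ₀ B ξ) : Filtration ℕ (inferInstance : MeasurableSpace Ω) where
  seq t := MeasurableSpace.comap (M.pastNoise θ₀ B ξ t) inferInstance
  mono' t t' htt' := by
    have e : M.pastNoise θ₀ B ξ t = (fun q : Param d × (Finset.range t' → M.Batch m × Param d) =>
        (q.1, fun i : Finset.range t => q.2 ⟨i, Finset.range_mono htt' i.2⟩))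
        ∘ M.pastNoise θ₀ B ξ t' := rfl
    change MeasurableSpace.comap (M.pastNoise θ₀ B ξ t) _
      ≤ MeasurableSpace.comap (M.pastNoise θ₀ B ξ t') _
    rw [e, ← MeasurableSpace.comap_comp]
    refine MeasurableSpace.comap_mono (Measurable.comap_le ?_)
    fun_prop
  le' t := (hdrive.measurable_pastNoise t).comap_le

/-- Two independences are combined: the initial state from the whole noise sequence, and the noise
before time `t` from the noise at time `t`. -/
theorem IsDriving.indepFun_pastNoise [IsProbabilityMeasure P] {M : FederatedModel X d S}
    {B : ℕ → Ω → M.Batch m} (hdrive : M.IsDriving P θ₀ B ξ) (t : ℕ) :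
    IndepFun (M.pastNoise θ₀ B ξ t) (fun ω => (B t ω, ξ t ω)) P := by
  have hpast : Measurable (fun ω (i : Finset.range t) => (B i ω, ξ i ω)) :=
    measurable_pi_lambda _ fun i => hdrive.measurable_pair i
  refine IndepFun.prodMk_left_of_prodMk_right hdrive.measurable_init hpast
    (hdrive.measurable_pair t) ?_ ?_
  · exact hdrive.indep_init.comp measurable_id (by fun_prop : Measurable
      fun q : ℕ → M.Batch m × Param d => ((fun i : Finset.range t => q i), q t))
  · have h := hdrive.iIndep.indepFun_finset (Finset.range t) {t} (by simp)
      fun i => hdrive.measurable_pair i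
    exact h.comp measurable_id (measurable_pi_apply (⟨t, by simp⟩ : ({t} : Finset ℕ)))

theorem IsDriving.isNoiseDriven [IsProbabilityMeasure P] {M : FederatedModel X d S}
    {B : ℕ → Ω → M.Batch m} (hdrive : M.IsDriving P θ₀ B ξ) (h : ℝ) :
    IsNoiseDriven P ((M.batchPMF m).toMeasure.prod (stdGaussian (Param d))) (M.update h)
      hdrive.filtration (M.chain θ₀ B ξ h) (fun t ω => (B t ω, ξ t ω)) where
  measurable_update := M.measurable_update h
  measurable_state t := by
    induction t with
    | zero =>
      exact measurable_fst.comp (comap_measurable (M.pastNoise θ₀ B ξ 0))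
    | succ t ih =>
      have h1 : Measurable[hdrive.filtration (t + 1)] (M.chain θ₀ B ξ h t) :=
        ih.mono (hdrive.filtration.mono t.le_succ) le_rfl
      have h2 : Measurable[hdrive.filtration (t + 1)] (fun ω => (B t ω, ξ t ω)) :=
        (by fun_prop : Measurable fun q : Param d × (Finset.range (t + 1) → M.Batch m × Param d) =>
          q.2 ⟨t, Finset.self_mem_range_succ t⟩).comp
            (comap_measurable (M.pastNoise θ₀ B ξ (t + 1)))
      exact (M.measurable_update h).comp (h1.prodMk h2)
  measurable_noise := hdrive.measurable_pair
  law := hdrive.law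
  indep t := (IndepFun_iff_Indep _ _ _).1 (hdrive.indepFun_pastNoise t)
  step t ω := rfl

end Chain

end FederatedModel

/-! ### Growth of the Poisson solution. -/

section PoissonGrowth

variable {E : Type*} [NormedAddCommGroup E] [InnerProductSpace ℝ E]

theorem norm_fderiv_eq_norm_iteratedFDeriv_one (f : E → ℝ) (x : E) :
    ‖fderiv ℝ f x‖ = ‖iteratedFDeriv ℝ 1 f x‖ := by
  rw [norm_iteratedFDeriv_one]

variable [FiniteDimensional ℝ E]

/-- Solving the equation for the Laplacian shows that it has two derivatives although `ψ` has only
three: the right side involves `φ` and first derivatives only. -/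
theorem laplacian_eq_of_poisson {f φ ψ : E → ℝ} {m₀ : ℝ}
    (hpoisson : ∀ x, 1 / 2 * inner ℝ (∇ f x) (∇ ψ x) + 1 / 2 * Laplacian.laplacian ψ x = φ x - m₀) :
    Laplacian.laplacian ψ = fun x => (2 * φ x - 2 * m₀) - inner ℝ (∇ f x) (∇ ψ x) := by
  ext x
  linarith [hpoisson x]

/-- The solution of a Poisson equation with coefficients of polynomial growth is dominated by
a power of the growth function. -/
theorem isDominated_of_poisson {f φ ψ Γ : E → ℝ} {m₀ a r c : ℝ} (hΓ : ∀ x, 1 ≤ Γ x)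
    (ha : 0 ≤ a) (hr : 0 ≤ r) (hc : 0 ≤ c) (hφ : ContDiff ℝ 2 φ) (hψ : ContDiff ℝ 3 ψ)
    (hf : ContDiff ℝ 3 f)
    (hpoisson : ∀ x, 1 / 2 * inner ℝ (∇ f x) (∇ ψ x) + 1 / 2 * Laplacian.laplacian ψ x = φ x - m₀)
    (hψb : ∀ k < 4, ∀ x, ‖iteratedFDeriv ℝ k ψ x‖ ≤ c * Γ x ^ a)
    (hφb : ∀ x, ‖iteratedFDeriv ℝ 2 φ x‖ ≤ c * Γ x ^ a)
    (hfb : ∀ j ∈ Finset.Icc 1 3, ∀ x, ‖iteratedFDeriv ℝ j f x‖ ≤ c * Γ x ^ r) {g : ℝ} (hg : 0 ≤ g) :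
    ∃ C : ℝ, IsDominated (fun x => Γ x ^ (a + 2 * r)) C ψ ∧
      (∀ x, |φ x - m₀| ≤ C * Γ x ^ (a + 2 * r)) ∧
      ∀ x G, ‖G‖ ≤ g * Γ x ^ r → IsDriftDominated (fun x => Γ x ^ (a + 2 * r)) C ψ x G := by
  set n : ℝ := (Module.finrank ℝ E : ℝ) with hn
  have hn0 : 0 ≤ n := Nat.cast_nonneg _
  have h1 : 0 ≤ n * c := mul_nonneg hn0 hc
  have h2 : 0 ≤ n * (4 * (c * c)) := by positivity
  have h3 : 0 ≤ c * g := mul_nonneg hc hg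
  have h4 : 0 ≤ c * g ^ 2 := by positivity
  have h5 : 0 ≤ n * c * g := by positivity
  have h6 : 0 ≤ c * c := mul_nonneg hc hc
  have hpos : ∀ x, 0 < Γ x := fun x => zero_lt_one.trans_le (hΓ x)
  have hle : ∀ x s, s ≤ a + 2 * r → Γ x ^ s ≤ Γ x ^ (a + 2 * r) := fun x s hs =>
    Real.rpow_le_rpow_of_exponent_le (hΓ x) hs
  have hw0 : ∀ x, 0 ≤ Γ x ^ (a + 2 * r) := fun x => (Real.rpow_pos_of_pos (hpos x) _).le
  have hΔ := laplacian_eq_of_poisson hpoisson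
  have hinner := contDiff_inner_gradient hf hψ
  have hψb' : ∀ k < 4, ∀ x, ‖iteratedFDeriv ℝ k ψ x‖ ≤ c * Γ x ^ (a + 2 * r) := fun k hk x =>
    (hψb k hk x).trans (mul_le_mul_of_nonneg_left (hle x a (by linarith)) hc)
  have hDΔ : ∀ x, ‖fderiv ℝ (Laplacian.laplacian ψ) x‖ ≤ n * c * Γ x ^ a := fun x => by
    refine (norm_fderiv_laplacian_le hψ x).trans ?_
    rw [mul_assoc]
    exact mul_le_mul_of_nonneg_left (hψb 3 (by norm_num) x) hn0
  have hpow : ∀ x, Γ x ^ r * Γ x ^ a ≤ Γ x ^ (a + 2 * r) := fun x => by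
    rw [← Real.rpow_add (hpos x)]
    exact hle x _ (by linarith)
  -- One constant that exceeds each coefficient arising below; every goal then needs only part of
  -- this sum.
  set C := 3 * c + n * c + n * (4 * (c * c)) + c * g + c * g ^ 2 + n * c * g + c * c with hC
  have hup : ∀ x t, t ≤ C → t * Γ x ^ (a + 2 * r) ≤ C * Γ x ^ (a + 2 * r) := fun x t ht =>
    mul_le_mul_of_nonneg_right ht (hw0 x)
  refine ⟨C, ⟨by positivity, hψ.of_le (by norm_num), ?_, ?_, ?_, ?_, ?_, ?_⟩, ?_, ?_⟩
  · rw [hΔ]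
    exact ((contDiff_const.mul hφ).sub contDiff_const).sub hinner
  · intro x
    have := hψb' 0 (by norm_num) x
    rw [norm_iteratedFDeriv_zero, Real.norm_eq_abs] at this
    exact this.trans (hup x c (by linarith))
  · intro x
    rw [norm_fderiv_eq_norm_iteratedFDeriv_one]
    exact (hψb' 1 (by norm_num) x).trans (hup x c (by linarith))
  · intro x
    exact (hψb' 2 (by norm_num) x).trans (hup x c (by linarith))
  · intro x
    exact (hDΔ x).trans ((mul_le_mul_of_nonneg_left (hle x a (by linarith)) h1).trans
      (hup x _ (by linarith)))
  · intro x
    have hφ2 : ContDiff ℝ 2 (fun x => (2 : ℝ) • φ x) := hφ.const_smul (2 : ℝ)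
    have e : Laplacian.laplacian ψ
        = fun x => (fun x => (2 : ℝ) • φ x - 2 * m₀) x - inner ℝ (∇ f x) (∇ ψ x) := hΔ
    rw [e, fun_iteratedFDeriv_sub_apply (hφ2.sub contDiff_const).contDiffAt hinner.contDiffAt,
      fun_iteratedFDeriv_sub_apply hφ2.contDiffAt contDiff_const.contDiffAt,
      iteratedFDeriv_const_of_ne (by norm_num), Pi.zero_apply, sub_zero,
      iteratedFDeriv_const_smul_apply' hφ.contDiffAt]
    refine (norm_sub_le _ _).trans ?_
    rw [norm_smul, Real.norm_ofNat]
    have k1 := norm_iteratedFDeriv_two_inner_gradient_le hf hψ (x := x) (fun j hj => hfb j hj x)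
      (fun j hj => hψb j (by simp at hj; omega) x)
    have k2 : c * Γ x ^ a ≤ c * Γ x ^ (a + 2 * r) :=
      mul_le_mul_of_nonneg_left (hle x a (by linarith)) hc
    have k3 : n * (4 * (c * Γ x ^ r * (c * Γ x ^ a)))
        ≤ n * (4 * (c * c)) * Γ x ^ (a + 2 * r) := by
      have := mul_le_mul_of_nonneg_left (hpow x) h2
      linarith
    have k4 := hup x (2 * c + n * (4 * (c * c))) (by linarith)
    have k5 := hφb x
    linarith
  · intro x
    rw [← hpoisson x]
    have k1 : |inner ℝ (∇ f x) (∇ ψ x)| ≤ c * c * Γ x ^ (a + 2 * r) := by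
      have hng : ∀ u : E → ℝ, ‖∇ u x‖ = ‖iteratedFDeriv ℝ 1 u x‖ := fun u => by
        rw [← norm_fderiv_eq_norm_iteratedFDeriv_one]
        exact LinearIsometryEquiv.norm_map _ _
      refine (abs_real_inner_le_norm _ _).trans ?_
      rw [hng, hng]
      calc _ ≤ (c * Γ x ^ r) * (c * Γ x ^ a) :=
            mul_le_mul (hfb 1 (by simp) x) (hψb 1 (by norm_num) x) (norm_nonneg _)
              (mul_nonneg hc (Real.rpow_pos_of_pos (hpos x) _).le)
        _ = c * c * (Γ x ^ r * Γ x ^ a) := by ring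
        _ ≤ _ := mul_le_mul_of_nonneg_left (hpow x) h6
    have k2 : |Laplacian.laplacian ψ x| ≤ n * c * Γ x ^ (a + 2 * r) := by
      refine (abs_laplacian_le x).trans ?_
      rw [mul_assoc]
      exact mul_le_mul_of_nonneg_left (hψb' 2 (by norm_num) x) hn0
    have k3 := hup x (c * c + n * c) (by linarith)
    have k4 := mul_nonneg (add_nonneg h6 h1) (hw0 x)
    rw [abs_le] at k1 k2 ⊢
    constructor <;> linarith [k1.1, k1.2, k2.1, k2.2]
  · intro x G hG
    have hΓa : ∀ z, 0 ≤ Γ z ^ a := fun z => (Real.rpow_pos_of_pos (hpos z) _).le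
    -- The squared drift in the second-order term grows like `Γ ^ (2 * r)`; with `D²ψ` this forces
    -- the exponent `a + 2 * r`.
    have hG2 : ‖G‖ ^ 2 ≤ g ^ 2 * Γ x ^ (2 * r) := by
      refine (pow_le_pow_left₀ (norm_nonneg _) hG 2).trans (le_of_eq ?_)
      rw [mul_pow, ← Real.rpow_mul_natCast (hpos x).le, mul_comm r]
      norm_num
    have hup2 : ∀ z t, t ≤ C → t * (Γ z ^ (a + 2 * r) + Γ x ^ (a + 2 * r))
        ≤ C * (Γ z ^ (a + 2 * r) + Γ x ^ (a + 2 * r)) := fun z t ht =>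
      mul_le_mul_of_nonneg_right ht (add_nonneg (hw0 z) (hw0 x))
    have hmul : ∀ z, Γ z ^ a * Γ x ^ r ≤ Γ z ^ (a + 2 * r) + Γ x ^ (a + 2 * r) := fun z =>
      rpow_mul_rpow_le_add (hΓ z) (hΓ x) ha hr (by linarith)
    have hmul2 : ∀ z, Γ z ^ a * Γ x ^ (2 * r) ≤ Γ z ^ (a + 2 * r) + Γ x ^ (a + 2 * r) := fun z =>
      rpow_mul_rpow_le_add (hΓ z) (hΓ x) ha (by linarith) le_rfl
    refine ⟨fun z => ?_, fun z => ?_, fun z => ?_⟩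
    · rw [norm_fderiv_eq_norm_iteratedFDeriv_one]
      calc _ ≤ (c * Γ z ^ a) * (g * Γ x ^ r) :=
            mul_le_mul (hψb 1 (by norm_num) z) hG (norm_nonneg _) (mul_nonneg hc (hΓa z))
        _ = c * g * (Γ z ^ a * Γ x ^ r) := by ring
        _ ≤ _ := (mul_le_mul_of_nonneg_left (hmul z) h3).trans (hup2 z _ (by linarith))
    · calc _ ≤ (c * Γ z ^ a) * (g ^ 2 * Γ x ^ (2 * r)) :=
            mul_le_mul (hψb 2 (by norm_num) z) hG2 (sq_nonneg _) (mul_nonneg hc (hΓa z))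
        _ = c * g ^ 2 * (Γ z ^ a * Γ x ^ (2 * r)) := by ring
        _ ≤ _ := (mul_le_mul_of_nonneg_left (hmul2 z) h4).trans (hup2 z _ (by linarith))
    · calc _ ≤ (n * c * Γ z ^ a) * (g * Γ x ^ r) :=
            mul_le_mul (hDΔ z) hG (norm_nonneg _) (mul_nonneg h1 (hΓa z))
        _ = n * c * g * (Γ z ^ a * Γ x ^ r) := by ring
        _ ≤ _ := (mul_le_mul_of_nonneg_left (hmul z) h5).trans (hup2 z _ (by linarith))

end PoissonGrowth

/-! ### Assembling the mean squared error bound. -/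

theorem mcAverage_sub_eq {Ω E : Type*} (φ : E → ℝ) (θ : ℕ → Ω → E) {T : ℕ} (hT : 0 < T) (m₀ : ℝ)
    (ω : Ω) : mcAverage φ θ T ω - m₀
      = (T : ℝ)⁻¹ * ∑ t ∈ Finset.range T, (φ (θ (t + 1) ω) - m₀) := by
  have hT' : (T : ℝ) ≠ 0 := Nat.cast_ne_zero.2 hT.ne'
  have h : ∀ n : ℕ, ∑ t ∈ Finset.Icc 1 n, φ (θ t ω) = ∑ t ∈ Finset.range n, φ (θ (t + 1) ω) := by
    intro n
    induction n with
    | zero => simp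
    | succ n ih => rw [Finset.sum_Icc_succ_top (by omega), ih, Finset.sum_range_succ]
  rw [mcAverage, h, Finset.sum_sub_distrib, Finset.sum_const, Finset.card_range, nsmul_eq_mul,
    mul_sub, inv_mul_cancel_left₀ hT']

theorem exists_common_growth_constant {ι E : Type*} [Fintype ι] {F u : ι → E → ℝ}
    (hu : ∀ i x, 0 ≤ u i x) (h : ∀ i, ∃ c : ℝ, ∀ x, F i x ≤ c * u i x) :
    ∃ c : ℝ, 0 ≤ c ∧ ∀ i x, F i x ≤ c * u i x := by
  choose c hc using h
  refine ⟨∑ i, |c i|, Finset.sum_nonneg fun i _ => abs_nonneg _, fun i x => (hc i x).trans ?_⟩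
  refine mul_le_mul_of_nonneg_right ?_ (hu i x)
  exact (le_abs_self _).trans
    (Finset.single_le_sum (f := fun i => |c i|) (fun i _ => abs_nonneg _) (Finset.mem_univ i))

theorem theorem2 {X : Type*} {d S m : ℕ} (hm : 0 < m) (M : FederatedModel X d S)
    -- the posterior is proper
    (hpost : Integrable M.post)
    -- Lipschitz log-surrogates
    (hq : ∀ s, ∃ K : NNReal, LipschitzWith K (fun θ => Real.log (M.q s θ)))
    -- bounded log-likelihood gradients within each shard
    (γ : Fin S → ℝ) (hγ : ∀ s i θ, ‖M.gradLik s i θ‖ ≤ γ s)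
    -- the chains, one for each step size in a set `H`
    {Ω : Type*} [MeasurableSpace Ω] (P : Measure Ω) [IsProbabilityMeasure P]
    (θ₀ : Ω → Param d) (B : ℕ → Ω → M.Batch m) (ξ : ℕ → Ω → Param d)
    (hdrive : M.IsDriving P θ₀ B ξ)
    (H : Set ℝ) (hH : ∀ h ∈ H, 0 < h)
    -- the test function and the solution of the Poisson equation
    (φ ψ : Param d → ℝ) (hφ : ContDiff ℝ 2 φ) (hφ_int : Integrable (fun θ => φ θ * M.post θ))
    (hψ : ContDiff ℝ 3 ψ) (hpoisson : ∀ θ, M.generator ψ θ = φ θ - M.postMean φ)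
    -- the dominating function and the growth exponents
    (Γ : Param d → ℝ) (hΓ : Measurable Γ) (hΓ_nonneg : ∀ θ, 0 ≤ Γ θ)
    (p : Fin 4 → ℝ) (hp : ∀ k, 0 < p k) (r : ℝ) (hr : 0 ≤ r)
    (hψ_growth : ∀ k : Fin 4, ∃ c : ℝ, ∀ θ, ‖iteratedFDeriv ℝ k ψ θ‖ ≤ c * Γ θ ^ p k)
    (hφ_growth : ∃ (k : Fin 4) (c : ℝ), ∀ θ, ‖iteratedFDeriv ℝ 2 φ θ‖ ≤ c * (1 + Γ θ ^ p k))
    (hlog : ContDiff ℝ 3 M.logPost)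
    (hlog_growth : ∀ j ∈ Finset.Icc 1 3, ∃ c : ℝ, ∀ θ,
      ‖iteratedFDeriv ℝ j M.logPost θ‖ ≤ c * (1 + Γ θ ^ r))
    (hΓ_moment : ∀ k : Fin 4, ∀ a : ℝ, 0 < a → a ≤ 2 * p k + 6 * r →
      ∃ c : ℝ, ∀ h ∈ H, ∀ t : ℕ,
        Integrable (fun ω => Γ (M.chain θ₀ B ξ h t ω) ^ a) P ∧
        ∫ ω, Γ (M.chain θ₀ B ξ h t ω) ^ a ∂P ≤ c)
    (hΓ_segment : ∀ k : Fin 4, ∀ a : ℝ, 0 < a → a ≤ 2 * p k + 6 * r →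
      ∃ c : ℝ, ∀ θ θ' : Param d, ∀ u ∈ Set.Ioo (0 : ℝ) 1,
        Γ (u • θ + (1 - u) • θ') ^ a ≤ c * (Γ θ ^ a + Γ θ' ^ a)) :
    ∃ C : ℝ, ∀ ε : Fin S → ℝ,
      (∀ s θ, (M.N s : ℝ)⁻¹ * ∑ i, ‖M.gradLik s i θ - (M.N s : ℝ)⁻¹ • M.gradSurr s θ‖ ^ 2
        ≤ ε s ^ 2) →
      ∀ h ∈ H, ∀ T : ℕ, 0 < T →
        Integrable (fun ω => (mcAverage φ (M.chain θ₀ B ξ h) T ω - M.postMean φ) ^ 2) P ∧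
        ∫ ω, (mcAverage φ (M.chain θ₀ B ξ h) T ω - M.postMean φ) ^ 2 ∂P
          ≤ C * (1 / (m * T) * ∑ s, (M.N s : ℝ) ^ 2 / M.prob s * ε s ^ 2 + 1 / (h * T) + h ^ 2) := by
  have hΓ1 : ∀ θ, 1 ≤ 1 + Γ θ := fun θ => by linarith [hΓ_nonneg θ]
  -- Take the largest exponent `p_*`; with base `1 + Γ ≥ 1` powers increase in the exponent, so it
  -- serves all derivatives.
  obtain ⟨k₀, -, hk₀⟩ := Finset.exists_max_image Finset.univ p Finset.univ_nonempty
  set a := p k₀ with ha_def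
  have ha : 0 < a := hp k₀
  have hpa : ∀ k, p k ≤ a := fun k => hk₀ k (Finset.mem_univ k)
  have hΓp : ∀ k θ, Γ θ ^ p k ≤ (1 + Γ θ) ^ a := fun k θ =>
    (Real.rpow_le_rpow (hΓ_nonneg θ) (by linarith) (hp k).le).trans
      (Real.rpow_le_rpow_of_exponent_le (hΓ1 θ) (hpa k))
  have hΛa : ∀ θ, 1 ≤ (1 + Γ θ) ^ a := fun θ => Real.one_le_rpow (hΓ1 θ) ha.le
  have hΛr : ∀ θ, 1 ≤ (1 + Γ θ) ^ r := fun θ => Real.one_le_rpow (hΓ1 θ) hr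
  -- growth constants
  obtain ⟨c₁, hc₁, hψb⟩ := exists_common_growth_constant
    (F := fun (k : Fin 4) θ => ‖iteratedFDeriv ℝ k ψ θ‖) (u := fun k θ => Γ θ ^ p k)
    (fun k θ => Real.rpow_nonneg (hΓ_nonneg θ) _) hψ_growth
  obtain ⟨kφ, cφ, hφb⟩ := hφ_growth
  obtain ⟨c₃, hc₃, hfb⟩ := exists_common_growth_constant
    (F := fun (j : Finset.Icc 1 3) θ => ‖iteratedFDeriv ℝ j M.logPost θ‖)
    (u := fun _ θ => 1 + Γ θ ^ r)
    (fun j θ => by have := Real.rpow_nonneg (hΓ_nonneg θ) r; linarith)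
    (fun j => hlog_growth j j.2)
  set c := c₁ + 2 * |cφ| + 2 * c₃ with hc_def
  have hc : 0 ≤ c := by positivity
  obtain ⟨g₀, hg₀, hdrift⟩ := M.norm_drift_le (m := m) hq γ hγ
  have hfb' : ∀ j ∈ Finset.Icc 1 3, ∀ θ,
      ‖iteratedFDeriv ℝ j M.logPost θ‖ ≤ c * (1 + Γ θ) ^ r := fun j hj θ => by
    refine (hfb ⟨j, hj⟩ θ).trans ?_
    have h1 : Γ θ ^ r ≤ (1 + Γ θ) ^ r := Real.rpow_le_rpow (hΓ_nonneg θ) (by linarith) hr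
    have h2 := hΛr θ
    calc c₃ * (1 + Γ θ ^ r) ≤ c₃ * (2 * (1 + Γ θ) ^ r) := by gcongr; linarith
      _ = 2 * c₃ * (1 + Γ θ) ^ r := by ring
      _ ≤ _ := mul_le_mul_of_nonneg_right (by rw [hc_def]; linarith [abs_nonneg cφ])
        (zero_le_one.trans h2)
  obtain ⟨C, hdom, hgen, hdriftdom⟩ := isDominated_of_poisson (Γ := fun θ => 1 + Γ θ)
    (f := M.logPost) (m₀ := M.postMean φ) (c := c) (g := c + g₀) hΓ1 ha.le hr hc hφ hψ hlog hpoisson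
    (fun k hk θ => by
      refine (hψb ⟨k, hk⟩ θ).trans ?_
      exact mul_le_mul (by rw [hc_def]; linarith [abs_nonneg cφ]) (hΓp _ θ)
        (Real.rpow_nonneg (hΓ_nonneg θ) _) hc)
    (fun θ => by
      refine (hφb θ).trans ?_
      have h0 : 0 ≤ Γ θ ^ p kφ := Real.rpow_nonneg (hΓ_nonneg θ) _
      calc cφ * (1 + Γ θ ^ p kφ) ≤ |cφ| * (2 * (1 + Γ θ) ^ a) :=
            mul_le_mul (le_abs_self _) (by linarith [hΓp kφ θ, hΛa θ]) (by linarith) (abs_nonneg _)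
        _ = 2 * |cφ| * (1 + Γ θ) ^ a := by ring
        _ ≤ _ := mul_le_mul_of_nonneg_right (by rw [hc_def]; linarith)
          (zero_le_one.trans (hΛa θ)))
    hfb' (by linarith)
  have hG : ∀ (θ : Param d) (b : M.Batch m),
      IsDriftDominated (fun θ => (1 + Γ θ) ^ (a + 2 * r)) C ψ θ (M.drift b θ) := fun θ b => by
    refine hdriftdom θ _ ((hdrift b θ).trans ?_)
    rw [FederatedModel.norm_gradient, norm_fderiv_eq_norm_iteratedFDeriv_one]
    have h1 := hfb' 1 (by simp) θ
    have h2 := mul_le_mul_of_nonneg_left (hΛr θ) hg₀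
    linarith
  -- the weight
  set κ := a + 2 * r with hκ_def
  have hκ : 0 < κ := by linarith
  obtain ⟨cs, hcs⟩ := hΓ_segment k₀ κ hκ (by linarith)
  have hw := isWeight_one_add_rpow hΓ hΓ_nonneg hκ.le hcs
  -- The mean square of the weight needs moments of order `2κ = 2 p_* + 4r`, within the admissible
  -- `2 p_* + 6r`.
  obtain ⟨cm, hcm⟩ := hΓ_moment k₀ (2 * κ) (by linarith) (by linarith)
  set K := 2 ^ (2 * κ) * (1 + |cm|) with hK_def
  have hwm : Measurable (fun θ => (1 + Γ θ) ^ κ) := hw.measurable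
  have hmom : ∀ h ∈ H, ∀ t, Integrable (fun ω => ((1 + Γ (M.chain θ₀ B ξ h t ω)) ^ κ) ^ 2) P ∧
      ∫ ω, ((1 + Γ (M.chain θ₀ B ξ h t ω)) ^ κ) ^ 2 ∂P ≤ K := by
    intro h hh t
    obtain ⟨hi, hle⟩ := hcm h hh t
    have hpt : ∀ ω, ((1 + Γ (M.chain θ₀ B ξ h t ω)) ^ κ) ^ 2
        ≤ 2 ^ (2 * κ) * (1 + Γ (M.chain θ₀ B ξ h t ω) ^ (2 * κ)) := fun ω => by
      rw [← Real.rpow_mul_natCast (by linarith [hΓ1 (M.chain θ₀ B ξ h t ω)]), mul_comm κ,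
        Nat.cast_ofNat]
      exact one_add_rpow_le (hΓ_nonneg _) (by linarith)
    have hi2 : Integrable (fun ω => 2 ^ (2 * κ) * (1 + Γ (M.chain θ₀ B ξ h t ω) ^ (2 * κ))) P :=
      ((integrable_const 1).add hi).const_mul _
    have hm1 : Measurable (M.chain θ₀ B ξ h t) := (hdrive.isNoiseDriven h).measurable_chain t
    have hi3 : Integrable (fun ω => ((1 + Γ (M.chain θ₀ B ξ h t ω)) ^ κ) ^ 2) P := by
      refine hi2.mono' ((hwm.comp hm1).pow_const 2).aestronglyMeasurable
        (Filter.Eventually.of_forall fun ω => ?_)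
      rw [Real.norm_of_nonneg (sq_nonneg _)]
      exact hpt ω
    refine ⟨hi3, (integral_mono hi3 hi2 hpt).trans ?_⟩
    rw [integral_const_mul, integral_add (integrable_const 1) hi, integral_const]
    simp only [probReal_univ, smul_eq_mul, mul_one]
    rw [hK_def]
    exact mul_le_mul_of_nonneg_left (by linarith [le_abs_self cm]) (by positivity)
  obtain ⟨C₃, hC₃, hdisp⟩ := hw.integral_random_step_sub_sq_le (β := M.Batch m) hdom
  set C₂ := 2 * ((Module.finrank ℝ (Param d) + 2) * C * (1 + 2 ^ κ * (1 + |cs|))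
    * (1 + 2 * (2 ^ κ * (1 + |cs|)))) ^ 2 with hC₂_def
  have hC₂ : 0 ≤ C₂ := by positivity
  have hK : 0 ≤ K := by positivity
  refine ⟨8 * K * (C ^ 2 + C₂ + C₃), fun ε _ h hh T hT => ?_⟩
  have hhpos := hH h hh
  have key := (hdrive.isNoiseDriven h).integral_average_sq_le hwm hψ.continuous.measurable
    (L := fun θ => φ θ - M.postMean φ) (hφ.continuous.measurable.sub_const _) hdom.abs_le hgen
    (hmom h hh) (C₂ := C₂) (C₃ := C₃) (h := h)
    (fun θ hint => by
      have hb := hw.sq_integral_random_step_sub_le hdom (M.batchPMF m).toMeasure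
        (G := fun b => M.drift b θ) (hG θ) hhpos.le hint
      rw [M.integral_drift hm] at hb
      -- By unbiasedness the mean drift is `∇ log π`, so the first-order term of the averaged step
      -- is the generator applied to `ψ`, that is, `φ - φ̄`.
      have e : φ θ - M.postMean φ
          = 1 / 2 * (fderiv ℝ ψ θ (∇ M.logPost θ) + Laplacian.laplacian ψ θ) := by
        rw [← hpoisson θ, FederatedModel.generator, inner_gradient_right]
        simp
        ring
      rw [e]
      exact hb)
    (fun h1 θ hint => hdisp (M.batchPMF m).toMeasure (fun b => M.drift b θ) θ (hG θ) h hhpos.le h1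
      hint)
    hhpos hC₂ hC₃ hT
  simp_rw [mcAverage_sub_eq φ (M.chain θ₀ B ξ h) hT]
  refine ⟨key.1, key.2.trans ?_⟩
  -- `key` already gives the bound by a multiple of `1 / (h T) + h²`; the mini-batch term is
  -- nonnegative and only enlarges the right side.
  have hε : 0 ≤ 1 / ((m : ℝ) * T) * ∑ s, (M.N s : ℝ) ^ 2 / M.prob s * ε s ^ 2 := by
    refine mul_nonneg (by positivity) (Finset.sum_nonneg fun s _ => ?_)
    have := (M.prob_pos s).le
    positivity
  refine mul_le_mul_of_nonneg_left (by linarith) (by positivity)
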